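/- **Conventions.** Let $\mathbb K\in\{\mathbb R,\mathbb C\}$. A Lie group is a Hausdorff smooth manifold modelled on a (Hausdorff) locally convex $\mathbb K$-vector space with smooth multiplication and inversion, where smooth means $C^n$ for all $n$ in the Michal–Bastiani sense (all directional derivatives exist, $df$ is continuous and inductively $C^{n-1}$). $\mathrm{Aut}$ of a Lie group is the group of its smooth automorphisms with smooth inverse. Let $G,N$ be Lie groups, $Z(N)$ the centre of $N$ and $C_N(n)(n')=nn'n^{-1}$. $C^p_s(G,N)$ ($p=1,2$) is the set of maps $G^p\to N$ that are smooth on an identity neighbourhood and take the value $1$ whenever one of the arguments is $1$; $C^2_{ss}(G,N)$ consists of those $\omega\in C^2_s(G,N)$ such that for every $g\in G$ the map $x\mapsto\omega(g,x)\,\omega(gxg^{-1},g)^{-1}$ is smooth on an identity neighbourhood. A *smooth outer action* is a map $S:G\to\mathrm{Aut}(N)$ with $S(1)=\mathrm{id}$, with $(g,n)\mapsto S(g)(n)$ smooth on $U\times N$ for some open identity neighbourhood $U$, and such that $S(g)S(g')S(gg')^{-1}=C_N(\omega(g,g'))$ for some $\omega\in C^2_s(G,N)$. Write $S\sim S'$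 if $S'=(C_N\circ h)\cdot S$ for some $h\in C^1_s(G,N)$. Then $g.z=S(g)(z)$ is an action of $G$ on $Z(N)$, and with the usual group differential $d_S$ and with $C^p_s(G,Z(N))$, $C^2_{ss}(G,Z(N))$ the $Z(N)$-valued elements of $C^p_s(G,N)$, $C^2_{ss}(G,N)$, put $$Z^1_s(G,Z(N))_S=\ker d_S|_{C^1_s(G,Z(N))},\qquad H^2_{ss}(G,Z(N))_S=\ker d_S|_{C^2_{ss}(G,Z(N))}\big/ d_S(C^1_s(G,Z(N))).$$ A *Lie group extension* of $G$ by $N$ is a short exact sequence $1\to N\xrightarrow{\iota}\widehat G\xrightarrow{q}G\to1$ of Lie group morphisms making $\widehat G$ a smooth (locally trivial) principal $N$-bundle over $G$. A section $\sigma\in C^1_s(G,\widehat G)$ of $q$ defines its factor system $(S',\omega)$ by $\iota(S'(g)(n))=\sigma(g)\iota(n)\sigma(g)^{-1}$ and $\iota(\omega(g,g'))=\sigma(g)\sigma(g')\sigma(gg')^{-1}$; two extensions with a common factor system are equivalent, and the extension *has kernel $[S]$* if $S'\sim S$. The group $H^2_{ss}(G,Z(N))_S$ acts on equivalence classes of extensions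 with kernel $[S]$: $[\widehat G']=[\beta].[\widehat G]$ iff, for some $\beta$ in the given cohomology class and some $\omega$, $\widehat G$ has factor system $(S,\omega)$ and $\widehat G'$ has factor system $(S,\beta\cdot\omega)$. For $(\varphi,\psi)\in\mathrm{Aut}(N)\times\mathrm{Aut}(G)$ let $(\varphi,\psi).[\widehat G]$ be the class of $1\to N\xrightarrow{\iota\circ\varphi^{-1}}\widehat G\xrightarrow{\psi\circ q}G\to1$, and put $$\mathrm{Comp}(S)=\{(\varphi,\psi)\in\mathrm{Aut}(N)\times\mathrm{Aut}(G):\ (g\mapsto \varphi\, S(\psi^{-1}(g))\,\varphi^{-1})\sim S\},$$ a group acting on $H^2_{ss}(G,Z(N))_S$ by $(\varphi,\psi).[\beta]=[\varphi\circ\beta\circ(\psi^{-1}\times\psi^{-1})]$. Finally $\mathrm{Aut}(\widehat G,N)=\{\nu\in\mathrm{Aut}(\widehat G):\nu(\iota(N))=\iota(N)\}$. **Theorem A.9.** Let $S$ be a smooth outer action of $G$ on $N$ and $1\to N\xrightarrow{\iota}\widehat G\xrightarrow{q}G\to1$ a Lie group extension with kernel $[S]$. Then: 1. $\Psi(f)(x)=\iota(f(q(x)))\,x$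 defines a group homomorphism $\Psi:Z^1_s(G,Z(N))_S\to\mathrm{Aut}(\widehat G,N)$. 2. There is a group homomorphism $\Phi:\mathrm{Aut}(\widehat G,N)\to\mathrm{Comp}(S)$, $\nu\mapsto(\nu_N,\nu_G)$, with $\iota\circ\nu_N=\nu\circ\iota$ and $\nu_G\circ q=q\circ\nu$. 3. For each $(\varphi,\psi)\in\mathrm{Comp}(S)$ there is a unique class $I(\varphi,\psi)\in H^2_{ss}(G,Z(N))_S$ with $(\varphi,\psi).[\widehat G]=I(\varphi,\psi).[\widehat G]$, and $I$ is a $1$-cocycle: $I(pp')=p.I(p')+I(p)$ for $p,p'\in\mathrm{Comp}(S)$. 4. The sequence $$1\to Z^1_s(G,Z(N))_S\xrightarrow{\Psi}\mathrm{Aut}(\widehat G,N)\xrightarrow{\Phi}\mathrm{Comp}(S)\xrightarrow{I}H^2_{ss}(G,Z(N))_S$$ is exact: $\Psi$ is injective, $\mathrm{im}\,\Psi=\ker\Phi$ and $\mathrm{im}\,\Phi=I^{-1}(0)$. -/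

import Mathlib

open Filter Topology Set
open scoped ComplexOrder IsMulCommutative

universe u v w

/-- Hausdorff locally convex topological vector spaces over `K` (real or complex). -/
class LocallyConvexTVS (K : Type*) (E : Type*) [RCLike K] [AddCommGroup E] [Module K E]
    [TopologicalSpace E] : Prop extends
    IsTopologicalAddGroup E, ContinuousSMul K E, LocallyConvexSpace K E, T2Space E

instance LocallyConvexTVS.prod (K : Type*) (E F : Type*) [RCLike K] [AddCommGroup E] [Module K E]
    [TopologicalSpace E] [LocallyConvexTVS K E] [AddCommGroup F] [Module K F]
    [TopologicalSpace F] [LocallyConvexTVS K F] : LocallyConvexTVS K (E × F) where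

/-- `df(x)(h) = y`: the difference quotients `t⁻¹ (f (x + t h) - f x)` tend to `y` as `t → 0` in `K`. -/
def HasDirDerivAt (K : Type*) [RCLike K] {X Y : Type*} [AddCommGroup X] [Module K X]
    [AddCommGroup Y] [Module K Y] [TopologicalSpace Y] (f : X → Y) (x h : X) (y : Y) : Prop :=
  Tendsto (fun t : K => t⁻¹ • (f (x + t • h) - f x)) (𝓝[≠] 0) (𝓝 y)

/-- `f` is a `Cⁿ`-map on the open set `U` in the sense of Michal and Bastiani (Keller's `Cⁿ_c`): `f` is
continuous, all directional derivatives exist on `U`, and `df : U × X → Y` is continuous and, inductively,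
a `Cⁿ⁻¹`-map. Smooth means `Cⁿ` for all `n`. -/
def CnOn (K : Type*) [RCLike K] {Y : Type v} [AddCommGroup Y] [Module K Y]
    [TopologicalSpace Y] : ℕ → ∀ {X : Type u} [AddCommGroup X] [Module K X]
    [TopologicalSpace X], (X → Y) → Set X → Prop
  | 0, _, _, _, _, f, U => ContinuousOn f U
  | n + 1, X, _, _, _, f, U => ContinuousOn f U ∧ ∃ df : X × X → Y,
      (∀ x ∈ U, ∀ h, HasDirDerivAt K f x h (df (x, h))) ∧ ContinuousOn df (U ×ˢ univ) ∧
        CnOn K n df (U ×ˢ univ)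

theorem CnOn.continuousOn {K : Type*} [RCLike K] {X : Type u} [AddCommGroup X]
    [Module K X] [TopologicalSpace X] {Y : Type v} [AddCommGroup Y] [Module K Y]
    [TopologicalSpace Y] {n : ℕ} {f : X → Y} {U : Set X} (h : CnOn K n f U) :
    ContinuousOn f U := by
  cases n with
  | zero => exact h
  | succ n => exact h.1

set_option linter.unusedSectionVars false

section Calculus

variable {K : Type*} [RCLike K]
variable {X : Type u} [AddCommGroup X] [Module K X] [TopologicalSpace X] [LocallyConvexTVS K X]
variable {Y : Type v} [AddCommGroup Y] [Module K Y] [TopologicalSpace Y] [LocallyConvexTVS K Y]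
variable {Z : Type w} [AddCommGroup Z] [Module K Z] [TopologicalSpace Z] [LocallyConvexTVS K Z]

theorem HasDirDerivAt.comp_curve {g : Y → Z} {V : Set Y} (hV : IsOpen V) {dg : Y × Y → Z}
    (hdg : ∀ y ∈ V, ∀ h, HasDirDerivAt K g y h (dg (y, h)))
    (hc : ContinuousOn dg (V ×ˢ univ)) {y : Y} (hy : y ∈ V) {k : K → Y} {k0 : Y}
    (hk : Tendsto k (𝓝[≠] 0) (𝓝 k0)) :
    Tendsto (fun t : K => t⁻¹ • (g (y + t • k t) - g y)) (𝓝[≠] 0) (𝓝 (dg (y, k0))) := by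
  let _ : Module ℝ Z := .restrictScalars ℝ K Z
  have _ : IsScalarTower ℝ K Z := .restrictScalars ℝ K Z
  have _ : ContinuousSMul ℝ Z := IsScalarTower.continuousSMul K
  have hconv : ∀ s : Set Z, Convex K s → Convex ℝ s := by
    intro s hs x hx y hy a b ha hb hab
    have := hs hx hy (a := (a : K)) (b := (b : K)) (by exact_mod_cast ha) (by exact_mod_cast hb)
      (by exact_mod_cast hab)
    simpa only [algebraMap_smul, ← RCLike.algebraMap_eq_ofReal] using this
  have _ : LocallyConvexSpace ℝ Z := by
    refine ⟨fun x => ?_⟩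
    refine (LocallyConvexSpace.convex_basis (𝕜 := K) x).to_hasBasis
      (fun s hs => ⟨s, ⟨hs.1, hconv s hs.2⟩, subset_rfl⟩) (fun s hs => ?_)
    obtain ⟨t, ht, hts⟩ := (LocallyConvexSpace.convex_basis (𝕜 := K) x).mem_iff.1 hs.1
    exact ⟨t, ht, hts⟩
  intro W hW
  obtain ⟨W1, hW1, hW1c, hW1W⟩ := exists_mem_nhds_isClosed_subset hW
  obtain ⟨C0, ⟨hC0, hC0c⟩, hC0W⟩ :=
    (LocallyConvexSpace.convex_basis (𝕜 := ℝ) (dg (y, k0))).mem_iff.1 hW1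
  have hCc : Convex ℝ (closure C0) := hC0c.closure
  have hCW : closure C0 ⊆ W := (closure_minimal hC0W hW1c).trans hW1W
  have hopen : IsOpen (V ×ˢ (univ : Set Y)) := hV.prod isOpen_univ
  have hmem : (y, k0) ∈ V ×ˢ (univ : Set Y) := ⟨hy, mem_univ _⟩
  have hev : ∀ᶠ p in 𝓝 (y, k0), p ∈ V ×ˢ (univ : Set Y) ∧ dg p ∈ closure C0 :=
    (hopen.eventually_mem hmem).and
      ((hc.continuousAt (hopen.mem_nhds hmem)).eventually
        (mem_of_superset hC0 subset_closure))
  rw [nhds_prod_eq, eventually_prod_iff] at hev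
  obtain ⟨pa, hpa, pb, hpb, hab⟩ := hev
  have hpa' : ∀ᶠ z in 𝓝 (0 : Y), pa (y + z) := by
    have : Tendsto (fun z : Y => y + z) (𝓝 0) (𝓝 y) := by
      simpa using (tendsto_const_nhds (x := y)).add (tendsto_id (α := Y) (x := 𝓝 0))
    exact this.eventually hpa
  obtain ⟨B, ⟨hB, hBb⟩, hBs⟩ := (nhds_basis_balanced K Y).mem_iff.1 hpa'
  have ht0 : Tendsto (fun t : K => t • k t) (𝓝[≠] 0) (𝓝 0) := by
    simpa using (tendsto_nhdsWithin_of_tendsto_nhds (tendsto_id (x := 𝓝 (0:K)))).smul hk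
  rw [mem_map]
  filter_upwards [ht0.eventually hB, hk.eventually hpb, self_mem_nhdsWithin] with t htB htk htne
  have htne : t ≠ 0 := htne
  apply hCW
  by_contra hD
  obtain ⟨f, a, hfa, hfD⟩ := geometric_hahn_banach_closed_point hCc isClosed_closure hD
  set F : ℝ → Z := fun s => t⁻¹ • g (y + (s : K) • (t • k t)) with hF
  have hin : ∀ s ∈ Icc (0:ℝ) 1, (y + (s : K) • (t • k t)) ∈ V ∧
      dg (y + (s : K) • (t • k t), k t) ∈ closure C0 := by
    intro s hs
    have h1 : (s : K) • (t • k t) ∈ B := hBb.smul_mem (by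
      rw [RCLike.norm_ofReal, abs_of_nonneg hs.1]; exact hs.2) htB
    have := hab (hBs h1) htk
    exact ⟨this.1.1, this.2⟩
  have hder : ∀ s ∈ Icc (0:ℝ) 1,
      HasDerivAt (fun s => f (F s)) (f (dg (y + (s : K) • (t • k t), k t))) s := by
    intro s hs
    rw [hasDerivAt_iff_tendsto_slope_zero]
    have h1 := hdg _ (hin s hs).1 (k t)
    have h2 : Tendsto (fun r : ℝ => (r : K) * t) (𝓝[≠] 0) (𝓝[≠] 0) := by
      refine tendsto_nhdsWithin_iff.2 ⟨?_, ?_⟩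
      · refine tendsto_nhdsWithin_of_tendsto_nhds ?_
        have : Continuous (fun r : ℝ => (r : K) * t) := by fun_prop
        simpa using this.tendsto 0
      · filter_upwards [self_mem_nhdsWithin] with r hr
        exact mul_ne_zero (by exact_mod_cast hr) htne
    have h3 := (f.continuous.tendsto _).comp (h1.comp h2)
    refine h3.congr' ?_
    filter_upwards [self_mem_nhdsWithin] with r hr
    have hr' : (r : K) ≠ 0 := by exact_mod_cast hr
    simp only [Function.comp, hF]
    rw [← map_sub, ← map_smul, ← smul_sub]
    congr 1
    rw [← algebraMap_smul K r⁻¹, RCLike.algebraMap_eq_ofReal, RCLike.ofReal_inv, mul_inv,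
      mul_smul (r : K)⁻¹, mul_smul (r : K) t, RCLike.ofReal_add, add_smul, add_assoc]
  obtain ⟨c, hc, hcs⟩ := exists_hasDerivAt_eq_slope (fun s => f (F s)) _ (zero_lt_one' ℝ)
    (fun s hs => (hder s hs).continuousAt.continuousWithinAt)
    (fun s hs => hder s (Ioo_subset_Icc_self hs))
  have h1 := hfa _ (hin c (Ioo_subset_Icc_self hc)).2
  rw [hcs] at h1
  simp only [hF, ← map_sub, ← smul_sub, RCLike.ofReal_one, RCLike.ofReal_zero, one_smul, zero_smul,
    add_zero, sub_zero, div_one] at h1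
  exact lt_asymm h1 hfD

theorem HasDirDerivAt.congr {f f' : X → Y} {x h : X} {y : Y} {U : Set X} (hU : IsOpen U)
    (hx : x ∈ U) (hff : EqOn f f' U) (hd : HasDirDerivAt K f x h y) :
    HasDirDerivAt K f' x h y := by
  refine Tendsto.congr' ?_ hd
  have h1 : Tendsto (fun t : K => x + t • h) (𝓝[≠] 0) (𝓝 x) := by
    refine tendsto_nhdsWithin_of_tendsto_nhds ?_
    have : Continuous (fun t : K => x + t • h) := by fun_prop
    simpa using this.tendsto 0
  filter_upwards [h1.eventually (hU.mem_nhds hx)] with t ht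
  rw [hff ht, hff hx]

theorem CnOn.congr {n : ℕ} {f f' : X → Y} {U : Set X} (hU : IsOpen U) (hff : EqOn f f' U)
    (hf : CnOn K n f U) : CnOn K n f' U := by
  cases n with
  | zero => exact ContinuousOn.congr hf hff.symm
  | succ n =>
    obtain ⟨h1, df, h2, h3, h4⟩ := hf
    exact ⟨h1.congr hff.symm, df, fun x hx h => (h2 x hx h).congr hU hx hff, h3, h4⟩

theorem CnOn.mono {n : ℕ} : ∀ {X : Type u} [AddCommGroup X] [Module K X] [TopologicalSpace X]
    {f : X → Y} {U V : Set X}, V ⊆ U → CnOn K n f U → CnOn K n f V := by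
  induction n with
  | zero => intro X _ _ _ f U V hVU hf; exact ContinuousOn.mono hf hVU
  | succ n ih =>
    intro X _ _ _ f U V hVU hf
    obtain ⟨h1, df, h2, h3, h4⟩ := hf
    have hs : V ×ˢ (univ : Set X) ⊆ U ×ˢ univ := prod_mono hVU subset_rfl
    exact ⟨h1.mono hVU, df, fun x hx h => h2 x (hVU hx) h, h3.mono hs, ih hs h4⟩

theorem CnOn.of_succ {n : ℕ} : ∀ {X : Type u} [AddCommGroup X] [Module K X]
    [TopologicalSpace X] {f : X → Y} {U : Set X}, CnOn K (n + 1) f U → CnOn K n f U := by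
  induction n with
  | zero => intro X _ _ _ f U hf; exact hf.1
  | succ n ih =>
    intro X _ _ _ f U hf
    obtain ⟨h1, df, h2, h3, h4⟩ := hf
    exact ⟨h1, df, h2, h3, ih h4⟩

theorem CnOn.of_locally {n : ℕ} : ∀ {X : Type u} [AddCommGroup X] [Module K X]
    [TopologicalSpace X] [LocallyConvexTVS K X] {f : X → Y} {U : Set X},
    (∀ x ∈ U, ∃ V, IsOpen V ∧ x ∈ V ∧ V ⊆ U ∧ CnOn K n f V) → CnOn K n f U := by
  have hcont : ∀ {X : Type u} [TopologicalSpace X] {f : X → Y} {U : Set X},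
      (∀ x ∈ U, ∃ V, IsOpen V ∧ x ∈ V ∧ ContinuousOn f V) → ContinuousOn f U := by
    intro X _ f U h x hx
    obtain ⟨V, hV, hxV, hc⟩ := h x hx
    exact (hc.continuousAt (hV.mem_nhds hxV)).continuousWithinAt
  induction n with
  | zero =>
    intro X _ _ _ _ f U h
    refine hcont fun x hx => ?_
    obtain ⟨V, hV, hxV, -, hc⟩ := h x hx
    exact ⟨V, hV, hxV, hc⟩
  | succ n ih =>
    intro X _ _ _ _ f U h
    choose! V hV hxV hVU hc using h
    have hcf := fun x (hx : x ∈ U) => (hc x hx).1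
    choose! df hd hdc hdn using fun x (hx : x ∈ U) => (hc x hx).2
    set d : X × X → Y := fun p => df p.1 p with hdd
    have heq : ∀ x ∈ U, EqOn (df x) d (V x ×ˢ univ) := by
      rintro x hx ⟨y, h⟩ ⟨hy, -⟩
      have hyU := hVU x hx hy
      exact tendsto_nhds_unique (hd x hx y hy h) (hd y hyU y (hxV y hyU) h)
    refine ⟨hcont fun x hx => ⟨V x, hV x hx, hxV x hx, hcf x hx⟩, d,
      fun x hx h => hd x hx x (hxV x hx) h, hcont ?_, ih ?_⟩
    · rintro ⟨x, h⟩ ⟨hx, -⟩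
      exact ⟨V x ×ˢ univ, (hV x hx).prod isOpen_univ, ⟨hxV x hx, mem_univ _⟩,
        (hdc x hx).congr (heq x hx).symm⟩
    · rintro ⟨x, h⟩ ⟨hx, -⟩
      exact ⟨V x ×ˢ univ, (hV x hx).prod isOpen_univ, ⟨hxV x hx, mem_univ _⟩,
        prod_mono (hVU x hx) subset_rfl,
        (hdn x hx).congr ((hV x hx).prod isOpen_univ) (heq x hx)⟩

theorem CnOn.const {n : ℕ} : ∀ {X : Type u} [AddCommGroup X] [Module K X]
    [TopologicalSpace X] (c : Y) (U : Set X), CnOn K n (fun _ : X => c) U := by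
  induction n generalizing Y with
  | zero => intro X _ _ _ c U; exact continuousOn_const
  | succ n ih =>
    intro X _ _ _ c U
    refine ⟨continuousOn_const, fun _ => 0, fun x _ h => ?_, continuousOn_const, ih _ _⟩
    simp [HasDirDerivAt]

theorem CnOn.clm {n : ℕ} : ∀ {X : Type u} [AddCommGroup X] [Module K X]
    [TopologicalSpace X] (L : X →L[K] Y) (U : Set X), CnOn K n L U := by
  induction n with
  | zero => intro X _ _ _ L U; exact L.continuous.continuousOn
  | succ n ih =>
    intro X _ _ _ L U
    refine ⟨L.continuous.continuousOn, L.comp (ContinuousLinearMap.snd K X X), fun x _ h => ?_,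
      (L.comp (ContinuousLinearMap.snd K X X)).continuous.continuousOn, ih _ _⟩
    refine tendsto_const_nhds.congr' ?_
    filter_upwards [self_mem_nhdsWithin] with t ht
    have ht : t ≠ 0 := ht
    simp [smul_smul, inv_mul_cancel₀ ht]

theorem CnOn.prodMk {n : ℕ} : ∀ {X : Type u} [AddCommGroup X] [Module K X]
    [TopologicalSpace X] {f : X → Y} {g : X → Z} {U : Set X},
    CnOn K n f U → CnOn K n g U → CnOn K n (fun x => (f x, g x)) U := by
  induction n with
  | zero => intro X _ _ _ f g U hf hg; exact ContinuousOn.prodMk hf hg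
  | succ n ih =>
    intro X _ _ _ f g U hf hg
    obtain ⟨h1, df, h2, h3, h4⟩ := hf
    obtain ⟨h1', dg, h2', h3', h4'⟩ := hg
    refine ⟨h1.prodMk h1', fun p => (df p, dg p), fun x hx h => ?_, h3.prodMk h3', ih h4 h4'⟩
    exact (h2 x hx h).prodMk_nhds (h2' x hx h)

theorem CnOn.comp_clm {n : ℕ} : ∀ {X : Type u} [AddCommGroup X] [Module K X]
    [TopologicalSpace X] {X' : Type w} [AddCommGroup X'] [Module K X'] [TopologicalSpace X']
    {f : X → Y} {U : Set X} (L : X' →L[K] X), CnOn K n f U →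
      CnOn K n (fun x => f (L x)) (L ⁻¹' U) := by
  induction n with
  | zero =>
    intro X _ _ _ X' _ _ _ f U L hf
    exact ContinuousOn.comp hf L.continuous.continuousOn (fun x hx => hx)
  | succ n ih =>
    intro X _ _ _ X' _ _ _ f U L hf
    obtain ⟨h1, df, h2, h3, h4⟩ := hf
    have key := ih (L.prodMap L) h4
    have hset : (L.prodMap L) ⁻¹' (U ×ˢ (univ : Set X)) = (L ⁻¹' U) ×ˢ (univ : Set X') := by
      ext p; simp
    rw [hset] at key
    refine ⟨h1.comp L.continuous.continuousOn (fun x hx => hx), _, fun x hx h => ?_,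
      key.continuousOn, key⟩
    simpa [HasDirDerivAt] using h2 (L x) hx (L h)

theorem CnOn.comp {n : ℕ} : ∀ {X : Type u} [AddCommGroup X] [Module K X]
    [TopologicalSpace X] [LocallyConvexTVS K X] {Y : Type v} [AddCommGroup Y] [Module K Y]
    [TopologicalSpace Y] [LocallyConvexTVS K Y] {f : X → Y} {g : Y → Z} {U : Set X} {V : Set Y},
    IsOpen U → IsOpen V → MapsTo f U V → CnOn K n g V → CnOn K n f U →
      CnOn K n (fun x => g (f x)) U := by
  induction n with
  | zero =>
    intro X _ _ _ _ Y _ _ _ _ f g U V _ _ hm hg hf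
    exact ContinuousOn.comp hg hf hm
  | succ n ih =>
    intro X _ _ _ _ Y _ _ _ _ f g U V hU hV hm hg hf
    have hfn := hf.of_succ
    obtain ⟨h1, df, h2, h3, h4⟩ := hf
    obtain ⟨h1', dg, h2', h3', h4'⟩ := hg
    have hU' : IsOpen (U ×ˢ (univ : Set X)) := hU.prod isOpen_univ
    have hV' : IsOpen (V ×ˢ (univ : Set Y)) := hV.prod isOpen_univ
    have hfst : CnOn K n (fun p : X × X => f p.1) (U ×ˢ univ) :=
      (hfn.comp_clm (ContinuousLinearMap.fst K X X)).mono (fun p hp => hp.1)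
    have hpair := hfst.prodMk h4
    have hm' : MapsTo (fun p : X × X => (f p.1, df p)) (U ×ˢ univ) (V ×ˢ univ) :=
      fun p hp => ⟨hm hp.1, mem_univ _⟩
    have key := ih hU' hV' hm' h4' hpair
    refine ⟨h1'.comp h1 hm, fun p => dg (f p.1, df p), fun x hx h => ?_, key.continuousOn, key⟩
    have hk := HasDirDerivAt.comp_curve hV h2' h3' (hm hx) (h2 x hx h)
    refine hk.congr' ?_
    filter_upwards [self_mem_nhdsWithin] with t ht
    have ht : t ≠ 0 := ht
    rw [smul_smul, mul_inv_cancel₀ ht, one_smul, add_sub_cancel]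

end Calculus

/-- The product of two charted spaces, modelled on the product of the model vector spaces. -/
instance prodChartedSpace' (E F M M' : Type*) [TopologicalSpace E] [TopologicalSpace F]
    [TopologicalSpace M] [TopologicalSpace M'] [ChartedSpace E M] [ChartedSpace F M'] :
    ChartedSpace (E × F) (M × M') :=
  prodChartedSpace E M F M'

/-- Smoothness on an open set `U` of a map between manifolds modelled on locally convex spaces:
`f` is continuous on `U`, and smooth on `U` in all charts. -/
def MapSmoothOn (K E F : Type*) [RCLike K] [AddCommGroup E] [Module K E] [TopologicalSpace E]
    [AddCommGroup F] [Module K F] [TopologicalSpace F] {M M' : Type*} [TopologicalSpace M]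
    [ChartedSpace E M] [TopologicalSpace M'] [ChartedSpace F M'] (f : M → M') (U : Set M) : Prop :=
  ContinuousOn f U ∧ ∀ e ∈ atlas E M, ∀ e' ∈ atlas F M', ∀ n : ℕ,
    CnOn K n (fun x => e' (f (e.symm x))) (e.target ∩ e.symm ⁻¹' (U ∩ f ⁻¹' e'.source))

/-- A Lie group modelled on the locally convex space `E`: a Hausdorff manifold with smooth chart
changes (that is, the identity is smooth with respect to any two charts), whose multiplication and
inversion are smooth. -/
class LCLieGroup (K E G : Type*) [RCLike K] [AddCommGroup E] [Module K E] [TopologicalSpace E]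
    [LocallyConvexTVS K E] [Group G] [TopologicalSpace G] [ChartedSpace E G] : Prop extends T2Space G where
  chart_smooth : MapSmoothOn K E E (id : G → G) univ
  mul_smooth : MapSmoothOn K (E × E) E (fun p : G × G => p.1 * p.2) univ
  inv_smooth : MapSmoothOn K E E (fun g : G => g⁻¹) univ

section Manifolds

variable {K : Type*} [RCLike K]
variable {E : Type*} [AddCommGroup E] [Module K E] [TopologicalSpace E] [LocallyConvexTVS K E]
variable {F : Type*} [AddCommGroup F] [Module K F] [TopologicalSpace F] [LocallyConvexTVS K F]
variable {H : Type*} [AddCommGroup H] [Module K H] [TopologicalSpace H] [LocallyConvexTVS K H]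
variable {M : Type*} [TopologicalSpace M] [ChartedSpace E M]
variable {P : Type*} [TopologicalSpace P] [ChartedSpace F P]
variable {Q : Type*} [TopologicalSpace Q] [ChartedSpace H Q]

theorem MapSmoothOn.mono {f : M → P} {U V : Set M} (hf : MapSmoothOn K E F f U) (h : V ⊆ U) :
    MapSmoothOn K E F f V :=
  ⟨hf.1.mono h, fun e he e' he' n => (hf.2 e he e' he' n).mono
    (inter_subset_inter_right _ (preimage_mono (inter_subset_inter_left _ h)))⟩

theorem MapSmoothOn.congr {f f' : M → P} {U : Set M} (hU : IsOpen U) (hff : EqOn f f' U)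
    (hf : MapSmoothOn K E F f U) : MapSmoothOn K E F f' U := by
  refine ⟨hf.1.congr hff.symm, fun e he e' he' n => ?_⟩
  have hset : U ∩ f' ⁻¹' e'.source = U ∩ f ⁻¹' e'.source := by
    ext x
    simp only [mem_inter_iff, mem_preimage]
    exact and_congr_right fun hx => by rw [hff hx]
  rw [hset]
  refine (hf.2 e he e' he' n).congr
    (e.isOpen_inter_preimage_symm (hf.1.isOpen_inter_preimage hU e'.open_source)) ?_
  intro x hx
  simp only [hff hx.2.1]

theorem MapSmoothOn.comp {f : M → P} {g : P → Q} {U : Set M} {V : Set P} (hU : IsOpen U)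
    (hV : IsOpen V) (hm : MapsTo f U V) (hg : MapSmoothOn K F H g V)
    (hf : MapSmoothOn K E F f U) : MapSmoothOn K E H (fun x => g (f x)) U := by
  refine ⟨hg.1.comp hf.1 hm, fun e he e'' he'' n => CnOn.of_locally fun x hx => ?_⟩
  set e' := chartAt F (f (e.symm x)) with he'
  have he'a : e' ∈ atlas F P := chart_mem_atlas F _
  set O : Set P := e'.source ∩ (V ∩ g ⁻¹' e''.source) with hO
  have hOo : IsOpen O := e'.open_source.inter (hg.1.isOpen_inter_preimage hV e''.open_source)
  refine ⟨e.target ∩ e.symm ⁻¹' (U ∩ f ⁻¹' O),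
    e.isOpen_inter_preimage_symm (hf.1.isOpen_inter_preimage hU hOo), ?_, ?_, ?_⟩
  · exact ⟨hx.1, hx.2.1, mem_chart_source F _, hm hx.2.1, hx.2.2⟩
  · rintro y ⟨h1, h2, h3, h4, h5⟩
    exact ⟨h1, h2, h5⟩
  · have h1 := CnOn.mono (V := e.target ∩ e.symm ⁻¹' (U ∩ f ⁻¹' O))
      (by exact fun y hy => ⟨hy.1, hy.2.1, hy.2.2.1⟩) (hf.2 e he e' he'a n)
    have h2 := hg.2 e' he'a e'' he'' n
    have hWo : IsOpen (e.target ∩ e.symm ⁻¹' (U ∩ f ⁻¹' O)) :=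
      e.isOpen_inter_preimage_symm (hf.1.isOpen_inter_preimage hU hOo)
    have h3 := CnOn.comp hWo
      (e'.isOpen_inter_preimage_symm (hg.1.isOpen_inter_preimage hV e''.open_source))
      (f := fun x => e' (f (e.symm x))) (g := fun y => e'' (g (e'.symm y))) ?_ h2 h1
    · refine h3.congr hWo fun y hy => ?_
      simp only [e'.left_inv hy.2.2.1]
    · intro y hy
      refine ⟨e'.map_source hy.2.2.1, ?_⟩
      simp only [mem_preimage, e'.left_inv hy.2.2.1]
      exact hy.2.2.2

theorem MapSmoothOn.prodMk {f : M → P} {g : M → Q} {U : Set M} (hf : MapSmoothOn K E F f U)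
    (hg : MapSmoothOn K E H g U) : MapSmoothOn K E (F × H) (fun x => (f x, g x)) U := by
  refine ⟨hf.1.prodMk hg.1, ?_⟩
  rintro e he e' ⟨e₁, he₁, e₂, he₂, rfl⟩ n
  exact CnOn.prodMk
    (CnOn.mono (by exact fun x hx => ⟨hx.1, hx.2.1, hx.2.2.1⟩) (hf.2 e he e₁ he₁ n))
    (CnOn.mono (by exact fun x hx => ⟨hx.1, hx.2.1, hx.2.2.2⟩) (hg.2 e he e₂ he₂ n))

theorem MapSmoothOn.const (c : P) (U : Set M) : MapSmoothOn K E F (fun _ : M => c) U :=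
  ⟨continuousOn_const, fun _ _ _ _ _ => CnOn.const _ _⟩

theorem MapSmoothOn.fst (hP : MapSmoothOn K F F (id : P → P) univ) :
    MapSmoothOn K (F × H) F (Prod.fst : P × Q → P) univ := by
  refine ⟨continuousOn_fst, ?_⟩
  rintro e ⟨e₁, he₁, e₂, he₂, rfl⟩ e' he' n
  exact CnOn.mono (by exact fun x hx => ⟨hx.1.1, mem_univ _, hx.2.2⟩)
    ((hP.2 e₁ he₁ e' he' n).comp_clm (ContinuousLinearMap.fst K F H))

theorem MapSmoothOn.snd (hQ : MapSmoothOn K H H (id : Q → Q) univ) :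
    MapSmoothOn K (F × H) H (Prod.snd : P × Q → Q) univ := by
  refine ⟨continuousOn_snd, ?_⟩
  rintro e ⟨e₁, he₁, e₂, he₂, rfl⟩ e' he' n
  exact CnOn.mono (by exact fun x hx => ⟨hx.1.2, mem_univ _, hx.2.2⟩)
    ((hQ.2 e₂ he₂ e' he' n).comp_clm (ContinuousLinearMap.snd K F H))

end Manifolds

section Groups

variable {K : Type*} [RCLike K]
variable {E : Type*} [AddCommGroup E] [Module K E] [TopologicalSpace E] [LocallyConvexTVS K E]
variable {F : Type*} [AddCommGroup F] [Module K F] [TopologicalSpace F] [LocallyConvexTVS K F]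
variable {M : Type*} [TopologicalSpace M] [ChartedSpace E M]
variable {P : Type*} [TopologicalSpace P] [ChartedSpace F P]

theorem MapSmoothOn.mul [Group P] [LCLieGroup K F P] {f g : M → P} {U : Set M} (hU : IsOpen U)
    (hf : MapSmoothOn K E F f U) (hg : MapSmoothOn K E F g U) :
    MapSmoothOn K E F (fun x => f x * g x) U :=
  MapSmoothOn.comp (g := fun p : P × P => p.1 * p.2) hU isOpen_univ (mapsTo_univ _ _)
    LCLieGroup.mul_smooth (hf.prodMk hg)

theorem MapSmoothOn.inv [Group P] [LCLieGroup K F P] {f : M → P} {U : Set M} (hU : IsOpen U)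
    (hf : MapSmoothOn K E F f U) : MapSmoothOn K E F (fun x => (f x)⁻¹) U :=
  MapSmoothOn.comp (g := fun p : P => p⁻¹) hU isOpen_univ (mapsTo_univ _ _)
    LCLieGroup.inv_smooth hf

end Groups

/-- The group `Aut(G)` of Lie group automorphisms: group automorphisms that are smooth with smooth inverse. -/
def LieAut (K E G : Type*) [RCLike K] [AddCommGroup E] [Module K E] [TopologicalSpace E]
    [LocallyConvexTVS K E] [Group G] [TopologicalSpace G] [ChartedSpace E G] [LCLieGroup K E G] :
    Subgroup (MulAut G) where
  carrier := {φ | MapSmoothOn K E E φ univ ∧ MapSmoothOn K E E φ.symm univ}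
  one_mem' := ⟨LCLieGroup.chart_smooth, LCLieGroup.chart_smooth⟩
  mul_mem' {φ ψ} hφ hψ :=
    ⟨MapSmoothOn.comp (g := φ) (f := ψ) isOpen_univ isOpen_univ (mapsTo_univ _ _) hφ.1 hψ.1,
      MapSmoothOn.comp (g := ψ.symm) (f := φ.symm) isOpen_univ isOpen_univ (mapsTo_univ _ _)
        hψ.2 hφ.2⟩
  inv_mem' {_} hφ := ⟨hφ.2, hφ.1⟩

/-- `f` is smooth on some open neighbourhood of the identity. -/
def SmoothNearOne (K E F : Type*) [RCLike K] [AddCommGroup E] [Module K E] [TopologicalSpace E]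
    [AddCommGroup F] [Module K F] [TopologicalSpace F] {M P : Type*} [One M] [TopologicalSpace M]
    [ChartedSpace E M] [TopologicalSpace P] [ChartedSpace F P] (f : M → P) : Prop :=
  ∃ U : Set M, IsOpen U ∧ 1 ∈ U ∧ MapSmoothOn K E F f U

section NearOne

variable {K : Type*} [RCLike K]
variable {E : Type*} [AddCommGroup E] [Module K E] [TopologicalSpace E] [LocallyConvexTVS K E]
variable {F : Type*} [AddCommGroup F] [Module K F] [TopologicalSpace F] [LocallyConvexTVS K F]
variable {H : Type*} [AddCommGroup H] [Module K H] [TopologicalSpace H] [LocallyConvexTVS K H]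
variable {M : Type*} [TopologicalSpace M] [ChartedSpace E M] [One M]
variable {P : Type*} [TopologicalSpace P] [ChartedSpace F P]
variable {Q : Type*} [TopologicalSpace Q] [ChartedSpace H Q]

theorem SmoothNearOne.const (c : P) : SmoothNearOne K E F (fun _ : M => c) :=
  ⟨univ, isOpen_univ, mem_univ _, MapSmoothOn.const _ _⟩

theorem SmoothNearOne.mul [Group P] [LCLieGroup K F P] {f g : M → P}
    (hf : SmoothNearOne K E F f) (hg : SmoothNearOne K E F g) :
    SmoothNearOne K E F (fun x => f x * g x) := by
  obtain ⟨U, hU, h1, hf⟩ := hf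
  obtain ⟨V, hV, h2, hg⟩ := hg
  exact ⟨U ∩ V, hU.inter hV, ⟨h1, h2⟩, MapSmoothOn.mul (hU.inter hV)
    (hf.mono inter_subset_left) (hg.mono inter_subset_right)⟩

theorem SmoothNearOne.inv [Group P] [LCLieGroup K F P] {f : M → P}
    (hf : SmoothNearOne K E F f) : SmoothNearOne K E F (fun x => (f x)⁻¹) := by
  obtain ⟨U, hU, h1, hf⟩ := hf
  exact ⟨U, hU, h1, MapSmoothOn.inv hU hf⟩

theorem SmoothNearOne.comp_left {f : M → P} {g : P → Q} (hg : MapSmoothOn K F H g univ)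
    (hf : SmoothNearOne K E F f) : SmoothNearOne K E H (fun x => g (f x)) := by
  obtain ⟨U, hU, h1, hf⟩ := hf
  exact ⟨U, hU, h1, MapSmoothOn.comp hU isOpen_univ (mapsTo_univ _ _) hg hf⟩

theorem SmoothNearOne.comp_right [One P] {f : P → Q} {g : M → P}
    (hf : SmoothNearOne K F H f) (hg : MapSmoothOn K E F g univ) (h1 : g 1 = 1) :
    SmoothNearOne K E H (fun x => f (g x)) := by
  obtain ⟨U, hU, hU1, hf⟩ := hf
  have ho : IsOpen (g ⁻¹' U) := by
    simpa using hg.1.isOpen_inter_preimage isOpen_univ hU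
  exact ⟨g ⁻¹' U, ho, by simpa [h1] using hU1,
    MapSmoothOn.comp ho hU (fun x hx => hx) hf (hg.mono (subset_univ _))⟩

end NearOne

section Cochains

variable (K EG EN : Type*) [RCLike K]
  [AddCommGroup EG] [Module K EG] [TopologicalSpace EG] [LocallyConvexTVS K EG]
  [AddCommGroup EN] [Module K EN] [TopologicalSpace EN] [LocallyConvexTVS K EN]
  {G N : Type*} [Group G] [TopologicalSpace G] [ChartedSpace EG G] [LCLieGroup K EG G]
  [Group N] [TopologicalSpace N] [ChartedSpace EN N] [LCLieGroup K EN N]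

/-- `C¹_s(G, N)`: normalized maps `G → N` that are smooth in an identity neighbourhood. -/
def IsCochain₁ (f : G → N) : Prop :=
  f 1 = 1 ∧ SmoothNearOne K EG EN f

/-- `C²_s(G, N)`: normalized maps `G × G → N` that are smooth in an identity neighbourhood. -/
def IsCochain₂ (ω : G × G → N) : Prop :=
  (∀ g g' : G, (g = 1 ∨ g' = 1) → ω (g, g') = 1) ∧ SmoothNearOne K (EG × EG) EN ω

/-- `C²_ss(G, N)`: those `ω ∈ C²_s(G, N)` for which all maps `x ↦ ω(g, x) ω(g x g⁻¹, g)⁻¹` are smooth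
in an identity neighbourhood of `G`. -/
def IsCochain₂ss (ω : G × G → N) : Prop :=
  IsCochain₂ K EG EN ω ∧
    ∀ g : G, SmoothNearOne K EG EN (fun x : G => ω (g, x) * (ω (g * x * g⁻¹, g))⁻¹)

variable (G N) in
/-- A smooth outer action of `G` on `N`: a map `S : G → Aut(N)` with `S(1) = id`, for which
`(g, n) ↦ S(g)(n)` is smooth on `U × N` for an open identity neighbourhood `U`, and such that
`S(g) S(g') S(g g')⁻¹` is conjugation by `ω(g, g')` for some `ω ∈ C²_s(G, N)`. -/
structure SmoothOuterAction where
  toFun : G → MulAut N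
  mem_lieAut : ∀ g, toFun g ∈ LieAut K EN N
  toFun_one : toFun 1 = 1
  smooth : ∃ U : Set G, IsOpen U ∧ 1 ∈ U ∧
    MapSmoothOn K (EG × EN) EN (fun p : G × N => toFun p.1 p.2) (U ×ˢ univ)
  outer : ∃ ω : G × G → N, IsCochain₂ K EG EN ω ∧
    ∀ g g', toFun g * toFun g' * (toFun (g * g'))⁻¹ = MulAut.conj (ω (g, g'))

/-- `S ∼ S'`: there is `h ∈ C¹_s(G, N)` with `S' = (C_N ∘ h) · S`. -/
def KernelEquiv (S S' : G → MulAut N) : Prop :=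
  ∃ h : G → N, IsCochain₁ K EG EN h ∧ ∀ g, S' g = MulAut.conj (h g) * S g

end Cochains

section Cohomology

variable {K EG EN : Type*} [RCLike K]
  [AddCommGroup EG] [Module K EG] [TopologicalSpace EG] [LocallyConvexTVS K EG]
  [AddCommGroup EN] [Module K EN] [TopologicalSpace EN] [LocallyConvexTVS K EN]
  {G N : Type*} [Group G] [TopologicalSpace G] [ChartedSpace EG G] [LCLieGroup K EG G]
  [Group N] [TopologicalSpace N] [ChartedSpace EN N] [LCLieGroup K EN N]

variable (K EG EN G N) in
/-- `C¹_s(G, Z(N))`; smoothness is that of maps into `N`. -/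
def CentralC₁ : Subgroup (G → Subgroup.center N) where
  carrier := {f | IsCochain₁ K EG EN (fun g => (f g : N))}
  one_mem' := ⟨rfl, SmoothNearOne.const 1⟩
  mul_mem' {f f'} hf hf' := ⟨by simp [hf.1, hf'.1], hf.2.mul hf'.2⟩
  inv_mem' {f} hf := ⟨by simp [hf.1], hf.2.inv⟩

variable (K EG EN G N) in
/-- `C²_ss(G, Z(N))`; smoothness is that of maps into `N`. -/
def CentralC₂ss : Subgroup (G × G → Subgroup.center N) where
  carrier := {f | IsCochain₂ss K EG EN (fun x => (f x : N))}
  one_mem' := ⟨⟨fun _ _ _ => rfl, SmoothNearOne.const 1⟩, fun g => by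
    simpa using SmoothNearOne.const (1 : N)⟩
  mul_mem' {f f'} hf hf' := by
    refine ⟨⟨fun g g' h => ?_, hf.1.2.mul hf'.1.2⟩, fun g => ?_⟩
    · simpa [hf'.1.1 g g' h] using hf.1.1 g g' h
    · have h := (hf.2 g).mul (hf'.2 g)
      convert h using 2 with x
      have aux : ∀ a a' b b' : N, (∀ y, y * b = b * y) →
          a * a' * (b * b')⁻¹ = a * b⁻¹ * (a' * b'⁻¹) := by
        intro a a' b b' hb
        have : b⁻¹ * (a' * b'⁻¹) = a' * b'⁻¹ * b⁻¹ := (Commute.inv_left (hb _).symm).eq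
        rw [mul_assoc a b⁻¹, this, mul_inv_rev]
        simp only [mul_assoc]
      exact aux _ _ _ _ (Subgroup.mem_center_iff.1 (f (g * x * g⁻¹, g)).2)
  inv_mem' {f} hf := by
    refine ⟨⟨fun g g' h => ?_, hf.1.2.inv⟩, fun g => ?_⟩
    · simpa using hf.1.1 g g' h
    · have h := (hf.2 g).inv
      convert h using 2 with x
      have hc := Subgroup.mem_center_iff.1 (f (g * x * g⁻¹, g)).2
      simp only [Pi.inv_apply, InvMemClass.coe_inv, mul_inv_rev, inv_inv]
      exact hc _

namespace SmoothOuterAction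

variable (S : SmoothOuterAction K EG EN G N)

/-- The automorphism `z ↦ S(g)(z)` of the centre `Z(N)`. -/
def centerAct (g : G) : Subgroup.center N ≃* Subgroup.center N :=
  Subgroup.centerCongr (S.toFun g)

/-- `(d_S f)(g, g') = S(g)(f(g')) f(g g')⁻¹ f(g)`, in multiplicative notation. -/
def d₁ : (G → Subgroup.center N) →* (G × G → Subgroup.center N) where
  toFun f := fun x => S.centerAct x.1 (f x.2) * (f (x.1 * x.2))⁻¹ * f x.1
  map_one' := by ext x; simp
  map_mul' f f' := by
    ext1 x
    simp only [Pi.mul_apply, map_mul, mul_inv]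
    ac_rfl

/-- `(d_S f)(g, g', g'') = S(g)(f(g', g'')) f(g g', g'')⁻¹ f(g, g' g'') f(g, g')⁻¹`, in multiplicative
notation. -/
def d₂ : (G × G → Subgroup.center N) →* (G × G × G → Subgroup.center N) where
  toFun f := fun x => S.centerAct x.1 (f (x.2.1, x.2.2)) * (f (x.1 * x.2.1, x.2.2))⁻¹ *
    f (x.1, x.2.1 * x.2.2) * (f (x.1, x.2.1))⁻¹
  map_one' := by ext x; simp
  map_mul' f f' := by
    ext1 x
    simp only [Pi.mul_apply, map_mul, mul_inv]
    ac_rfl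

/-- `Z¹_s(G, Z(N))_S`. -/
def Z₁ : Subgroup (G → Subgroup.center N) := CentralC₁ K EG EN G N ⊓ S.d₁.ker

/-- `Z²_ss(G, Z(N))_S`. -/
def Z₂ss : Subgroup (G × G → Subgroup.center N) := CentralC₂ss K EG EN G N ⊓ S.d₂.ker

/-- `B²_s(G, Z(N))_S = d_S(C¹_s(G, Z(N)))`. -/
def B₂ : Subgroup (G × G → Subgroup.center N) := (CentralC₁ K EG EN G N).map S.d₁

/-- `H²_ss(G, Z(N))_S = Z²_ss(G, Z(N))_S / B²_s(G, Z(N))_S`, written multiplicatively. -/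
abbrev H₂ss : Type _ := S.Z₂ss ⧸ S.B₂.subgroupOf S.Z₂ss

end SmoothOuterAction

/-- `(φ, ψ).S = c_φ ∘ S ∘ ψ⁻¹`. -/
def pairAct (p : LieAut K EN N × LieAut K EG G) (S : G → MulAut N) : G → MulAut N :=
  fun g => (p.1 : MulAut N) * S ((p.2 : MulAut G)⁻¹ g) * (p.1 : MulAut N)⁻¹

theorem IsCochain₁.pair {h : G → N} (hh : IsCochain₁ K EG EN h)
    (p : LieAut K EN N × LieAut K EG G) :
    IsCochain₁ K EG EN (fun g => (p.1 : MulAut N) (h ((p.2 : MulAut G)⁻¹ g))) :=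
  ⟨by simp [hh.1], (hh.2.comp_right (p.2⁻¹).2.1 (map_one _)).comp_left p.1.2.1⟩

theorem conj_apply_aut (φ : MulAut N) (n : N) :
    MulAut.conj (φ n) = φ * MulAut.conj n * φ⁻¹ := by
  ext m; simp

/-- `Comp(S)`: the pairs `(φ, ψ) ∈ Aut(N) × Aut(G)` with `(φ, ψ).S ∼ S`. -/
def SmoothOuterAction.Comp (S : SmoothOuterAction K EG EN G N) :
    Subgroup (LieAut K EN N × LieAut K EG G) where
  carrier := {p | KernelEquiv K EG EN (pairAct p S.toFun) S.toFun}
  one_mem' := ⟨fun _ => 1, ⟨rfl, SmoothNearOne.const 1⟩, fun g => by simp [pairAct]⟩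
  mul_mem' := by
    rintro p p' ⟨h, hh, e⟩ ⟨h', hh', e'⟩
    refine ⟨fun g => h g * (p.1 : MulAut N) (h' ((p.2 : MulAut G)⁻¹ g)),
      ⟨by simp [hh.1, hh'.1], hh.2.mul (hh'.pair p).2⟩, fun g => ?_⟩
    rw [e, map_mul, conj_apply_aut]
    simp only [pairAct]
    rw [e' ((p.2 : MulAut G)⁻¹ g)]
    simp only [pairAct, Prod.fst_mul, Prod.snd_mul, Subgroup.coe_mul, mul_inv_rev, MulAut.mul_apply]
    group
  inv_mem' := by
    rintro p ⟨h, hh, e⟩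
    refine ⟨fun g => ((p⁻¹).1 : MulAut N) (h (((p⁻¹).2 : MulAut G)⁻¹ g))⁻¹,
      ⟨by simp [hh.1], ?_⟩, fun g => ?_⟩
    · have := (hh.pair p⁻¹).2.inv
      simpa using this
    · have := e ((p.2 : MulAut G) g)
      show _ = MulAut.conj (((p⁻¹).1 : MulAut N) (h (((p⁻¹).2 : MulAut G)⁻¹ g))⁻¹) * _
      rw [map_inv, map_inv, conj_apply_aut]
      simp only [pairAct, Prod.fst_inv, Prod.snd_inv, Subgroup.coe_inv, inv_inv] at this ⊢
      rw [this]
      simp [mul_assoc]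

theorem SmoothOuterAction.comp_center {S : SmoothOuterAction K EG EN G N}
    {p : LieAut K EN N × LieAut K EG G} (hp : p ∈ S.Comp) (g : G) (z : Subgroup.center N) :
    Subgroup.centerCongr (p.1 : MulAut N) (S.centerAct g z) =
      S.centerAct ((p.2 : MulAut G) g) (Subgroup.centerCongr (p.1 : MulAut N) z) := by
  obtain ⟨h, -, e⟩ := hp
  have := congrArg (fun f : MulAut N => f ((p.1 : MulAut N) z)) (e ((p.2 : MulAut G) g))
  apply Subtype.ext
  have hz : (p.1 : MulAut N) (S.toFun g z) ∈ Subgroup.center N :=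
    (Subgroup.centerCongr (p.1 : MulAut N) (S.centerAct g z)).2
  have hc := Subgroup.mem_center_iff.1 hz (h ((p.2 : MulAut G) g))
  simp only [pairAct, MulAut.mul_apply, MulAut.inv_apply_self, MulAut.conj_apply] at this
  rw [hc, mul_inv_cancel_right] at this
  exact this.symm

/-- `(φ, ψ).f = φ ∘ f ∘ ψ⁻¹` for `f : G → Z(N)`. -/
def centralPull₁ (p : LieAut K EN N × LieAut K EG G) :
    (G → Subgroup.center N) →* (G → Subgroup.center N) where
  toFun f := fun x => Subgroup.centerCongr (p.1 : MulAut N) (f ((p.2 : MulAut G)⁻¹ x))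
  map_one' := by ext x; simp
  map_mul' f f' := by ext1 x; simp

/-- `(φ, ψ).f = φ ∘ f ∘ (ψ⁻¹ × ψ⁻¹)` for `f : G × G → Z(N)`. -/
def centralPull₂ (p : LieAut K EN N × LieAut K EG G) :
    (G × G → Subgroup.center N) →* (G × G → Subgroup.center N) where
  toFun f := fun x => Subgroup.centerCongr (p.1 : MulAut N)
    (f ((p.2 : MulAut G)⁻¹ x.1, (p.2 : MulAut G)⁻¹ x.2))
  map_one' := by ext x; simp
  map_mul' f f' := by ext1 x; simp

theorem SmoothOuterAction.d₁_pull {S : SmoothOuterAction K EG EN G N}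
    {p : LieAut K EN N × LieAut K EG G} (hp : p ∈ S.Comp) (f : G → Subgroup.center N) :
    S.d₁ (centralPull₁ p f) = centralPull₂ p (S.d₁ f) := by
  ext1 x
  simp [d₁, centralPull₁, centralPull₂, S.comp_center hp]

theorem SmoothOuterAction.pull_mem_Z₂ss {S : SmoothOuterAction K EG EN G N}
    {p : LieAut K EN N × LieAut K EG G} (hp : p ∈ S.Comp) {f : G × G → Subgroup.center N}
    (hf : f ∈ S.Z₂ss) : centralPull₂ p f ∈ S.Z₂ss := by
  obtain ⟨⟨⟨hn, hs⟩, hss⟩, hd⟩ := hf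
  refine ⟨⟨⟨fun g g' h => ?_, ?_⟩, fun g => ?_⟩, ?_⟩
  · have := hn ((p.2 : MulAut G)⁻¹ g) ((p.2 : MulAut G)⁻¹ g') (by simpa using h)
    have h1 : f ((p.2 : MulAut G)⁻¹ g, (p.2 : MulAut G)⁻¹ g') = 1 := Subtype.ext this
    show ((Subgroup.centerCongr (p.1 : MulAut N)
      (f ((p.2 : MulAut G)⁻¹ g, (p.2 : MulAut G)⁻¹ g')) : Subgroup.center N) : N) = 1
    rw [h1, map_one, OneMemClass.coe_one]
  · have hpsi := (p.2⁻¹).2.1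
    have hm : MapSmoothOn K (EG × EG) (EG × EG) (fun x : G × G =>
        ((p.2 : MulAut G)⁻¹ x.1, (p.2 : MulAut G)⁻¹ x.2)) univ :=
      MapSmoothOn.prodMk
        (MapSmoothOn.comp isOpen_univ isOpen_univ (mapsTo_univ _ _) hpsi
          (MapSmoothOn.fst LCLieGroup.chart_smooth))
        (MapSmoothOn.comp isOpen_univ isOpen_univ (mapsTo_univ _ _) hpsi
          (MapSmoothOn.snd LCLieGroup.chart_smooth))
    exact SmoothNearOne.comp_left (g := (p.1 : MulAut N)) p.1.2.1 (hs.comp_right hm (by simp))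
  · have h := SmoothNearOne.comp_left (g := (p.1 : MulAut N)) p.1.2.1
      ((hss ((p.2 : MulAut G)⁻¹ g)).comp_right (g := ((p.2 : MulAut G)⁻¹ : MulAut G)) (p.2⁻¹).2.1
        (_root_.map_one _))
    convert h using 2 with x
    simp [centralPull₂, Subgroup.centerCongr, Submonoid.centerCongr, Subsemigroup.centerCongr]
    rfl
  · have hd : S.d₂ f = 1 := hd
    show S.d₂ (centralPull₂ p f) = 1
    ext1 x
    have := congrArg (Subgroup.centerCongr (p.1 : MulAut N)) (congrFun hd
      ((p.2 : MulAut G)⁻¹ x.1, (p.2 : MulAut G)⁻¹ x.2.1, (p.2 : MulAut G)⁻¹ x.2.2))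
    simpa [d₂, centralPull₂, S.comp_center hp] using this

namespace SmoothOuterAction

variable (S : SmoothOuterAction K EG EN G N)

/-- The action `(φ, ψ).[β] = [(φ, ψ).β]` of `Comp(S)` on `H²_ss(G, Z(N))_S`. -/
def compAct (p : S.Comp) : S.H₂ss →* S.H₂ss :=
  QuotientGroup.map _ _
    (((centralPull₂ (p : LieAut K EN N × LieAut K EG G)).comp S.Z₂ss.subtype).codRestrict S.Z₂ss
      (fun f => S.pull_mem_Z₂ss p.2 f.2)) (by
    rintro ⟨f, hf⟩ ⟨a, ha, hd⟩
    exact ⟨centralPull₁ (p : LieAut K EN N × LieAut K EG G) a,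
      IsCochain₁.pair (h := fun g => (a g : N)) ha _,
      (S.d₁_pull p.2 a).trans (congrArg _ hd)⟩)

instance : MulDistribMulAction S.Comp S.H₂ss where
  smul p c := S.compAct p c
  one_smul c := by
    obtain ⟨f, rfl⟩ := QuotientGroup.mk_surjective c
    rfl
  mul_smul p p' c := by
    obtain ⟨f, rfl⟩ := QuotientGroup.mk_surjective c
    rfl
  smul_one p := map_one (S.compAct p)
  smul_mul p c c' := map_mul (S.compAct p) c c'

end SmoothOuterAction

end Cohomology

/-- A Lie group extension `1 → N → H → G → 1` (with `H` in the role of `Ĝ`): a short exact sequence of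
smooth homomorphisms that makes `H` a smooth principal `N`-bundle over `G`. The last field says that
over an open neighbourhood `U` of each point there is a smooth section `s` for which the bijection
`U × N → q⁻¹(U)`, `(x, n) ↦ s(x) ι(n)` has a smooth inverse `y ↦ (q y, r y)`. -/
structure LieGroupExtension (K EN EH EG N H G : Type*) [RCLike K]
    [AddCommGroup EN] [Module K EN] [TopologicalSpace EN] [LocallyConvexTVS K EN]
    [AddCommGroup EH] [Module K EH] [TopologicalSpace EH] [LocallyConvexTVS K EH]
    [AddCommGroup EG] [Module K EG] [TopologicalSpace EG] [LocallyConvexTVS K EG]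
    [Group N] [TopologicalSpace N] [ChartedSpace EN N] [LCLieGroup K EN N]
    [Group H] [TopologicalSpace H] [ChartedSpace EH H] [LCLieGroup K EH H]
    [Group G] [TopologicalSpace G] [ChartedSpace EG G] [LCLieGroup K EG G] where
  ι : N →* H
  q : H →* G
  ι_injective : Function.Injective ι
  q_surjective : Function.Surjective q
  range_eq_ker : ι.range = q.ker
  ι_smooth : MapSmoothOn K EN EH ι univ
  q_smooth : MapSmoothOn K EH EG q univ
  locally_trivial : ∀ g : G, ∃ U : Set G, IsOpen U ∧ g ∈ U ∧ ∃ (s : G → H) (r : H → N),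
    MapSmoothOn K EG EH s U ∧ MapSmoothOn K EH EN r (q ⁻¹' U) ∧ (∀ x ∈ U, q (s x) = x) ∧
      ∀ y ∈ q ⁻¹' U, y = s (q y) * ι (r y)

namespace LieGroupExtension

variable {K EN EH EG N H G : Type*} [RCLike K]
  [AddCommGroup EN] [Module K EN] [TopologicalSpace EN] [LocallyConvexTVS K EN]
  [AddCommGroup EH] [Module K EH] [TopologicalSpace EH] [LocallyConvexTVS K EH]
  [AddCommGroup EG] [Module K EG] [TopologicalSpace EG] [LocallyConvexTVS K EG]
  [Group N] [TopologicalSpace N] [ChartedSpace EN N] [LCLieGroup K EN N]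
  [Group H] [TopologicalSpace H] [ChartedSpace EH H] [LCLieGroup K EH H]
  [Group G] [TopologicalSpace G] [ChartedSpace EG G] [LCLieGroup K EG G]

/-- The extension `(φ, ψ).X`, with inclusion `ι ∘ φ⁻¹` and projection `ψ ∘ q`. -/
def twist (X : LieGroupExtension K EN EH EG N H G) (p : LieAut K EN N × LieAut K EG G) :
    LieGroupExtension K EN EH EG N H G where
  ι := X.ι.comp ((p.1 : MulAut N)⁻¹ : MulAut N).toMonoidHom
  q := (p.2 : MulAut G).toMonoidHom.comp X.q
  ι_injective := X.ι_injective.comp (MulEquiv.injective _)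
  q_surjective := (MulEquiv.surjective (p.2 : MulAut G)).comp X.q_surjective
  range_eq_ker := by
    ext x
    have h := SetLike.ext_iff.1 X.range_eq_ker x
    simp only [MonoidHom.mem_range, MonoidHom.mem_ker] at h ⊢
    constructor
    · rintro ⟨n, rfl⟩
      have := (SetLike.ext_iff.1 X.range_eq_ker (X.ι ((p.1 : MulAut N)⁻¹ n))).1 ⟨_, rfl⟩
      rw [MonoidHom.mem_ker] at this
      simpa using this
    · intro hx
      have hx' : X.q x = 1 := by simpa using hx
      obtain ⟨n, rfl⟩ := h.2 hx'
      exact ⟨(p.1 : MulAut N) n, by simp⟩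
  ι_smooth := MapSmoothOn.comp (g := X.ι) (f := ((p.1 : MulAut N)⁻¹ : MulAut N)) isOpen_univ isOpen_univ (mapsTo_univ _ _) X.ι_smooth (p.1⁻¹).2.1
  q_smooth := MapSmoothOn.comp (g := (p.2 : MulAut G)) (f := X.q) isOpen_univ isOpen_univ (mapsTo_univ _ _) p.2.2.1 X.q_smooth
  locally_trivial g := by
    obtain ⟨U, hU, hg, s, r, hs, hr, h1, h2⟩ := X.locally_trivial ((p.2 : MulAut G)⁻¹ g)
    have hpsi := (p.2⁻¹).2.1
    have hU' : IsOpen (((p.2 : MulAut G)⁻¹ : MulAut G) ⁻¹' U) := by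
      simpa using hpsi.1.isOpen_inter_preimage isOpen_univ hU
    have hqU : IsOpen (X.q ⁻¹' U) := by
      simpa using X.q_smooth.1.isOpen_inter_preimage isOpen_univ hU
    have hset : ((p.2 : MulAut G).toMonoidHom.comp X.q) ⁻¹' (((p.2 : MulAut G)⁻¹ : MulAut G) ⁻¹' U)
        = X.q ⁻¹' U := by
      ext y; simp
    refine ⟨_, hU', hg, fun x => s ((p.2 : MulAut G)⁻¹ x), fun y => (p.1 : MulAut N) (r y),
      MapSmoothOn.comp hU' hU (fun x hx => hx) hs (hpsi.mono (subset_univ _)), ?_, ?_, ?_⟩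
    · rw [hset]
      exact MapSmoothOn.comp hqU isOpen_univ (mapsTo_univ _ _) p.1.2.1 hr
    · intro x hx
      show (p.2 : MulAut G) (X.q (s ((p.2 : MulAut G)⁻¹ x))) = x
      rw [h1 _ hx, MulAut.apply_inv_self]
    · intro y hy
      rw [hset] at hy
      simpa using h2 y hy

/-- `(S, ω)` is the factor system `(C_N ∘ σ, δ_σ)` of a normalized locally smooth section `σ` of `q`.
In other words, the map `(n, g) ↦ ι(n) σ(g)` is an equivalence of extensions from
`N ×_(S,ω) G`, the set `N × G` with the product `(n, g)(n', g') = (n S(g)(n') ω(g, g'), g g')`, onto `X`. -/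
def HasFactorSystem (X : LieGroupExtension K EN EH EG N H G) (S : G → MulAut N)
    (ω : G × G → N) : Prop :=
  ∃ σ : G → H, IsCochain₁ K EG EH σ ∧ (∀ g, X.q (σ g) = g) ∧
    (∀ g n, X.ι (S g n) = σ g * X.ι n * (σ g)⁻¹) ∧
    ∀ g g', X.ι (ω (g, g')) = σ g * σ g' * (σ (g * g'))⁻¹

/-- The extension `X` corresponds to the smooth `G`-kernel `[S]`: some (equivalently, every) normalized
locally smooth section induces an outer action equivalent to `S`. -/
def HasKernel (X : LieGroupExtension K EN EH EG N H G) (S : SmoothOuterAction K EG EN G N) :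
    Prop :=
  ∃ (S' : G → MulAut N) (ω' : G × G → N), X.HasFactorSystem S' ω' ∧
    KernelEquiv K EG EN S.toFun S'

/-- `[X'] = c.[X]` for the action of `H²_ss(G, Z(N))_S` on the set `Ext(G, N)_[S]` of equivalence classes of
extensions, `[β].[N ×_(S,ω) G] = [N ×_(S,β·ω) G]`. -/
def IsClassShift {EH' H' : Type*}
    [AddCommGroup EH'] [Module K EH'] [TopologicalSpace EH'] [LocallyConvexTVS K EH']
    [Group H'] [TopologicalSpace H'] [ChartedSpace EH' H'] [LCLieGroup K EH' H']
    (S : SmoothOuterAction K EG EN G N) (c : S.H₂ss) (X : LieGroupExtension K EN EH EG N H G)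
    (X' : LieGroupExtension K EN EH' EG N H' G) : Prop :=
  ∃ (β : S.Z₂ss) (ω : G × G → N), (β : S.H₂ss) = c ∧ X.HasFactorSystem S.toFun ω ∧
    X'.HasFactorSystem S.toFun (fun x => ((β : G × G → Subgroup.center N) x : N) * ω x)

/-- The group `Aut(Ĝ, N)` of Lie group automorphisms of `Ĝ = H` that map (the image of) `N` onto itself. -/
def Aut (X : LieGroupExtension K EN EH EG N H G) : Subgroup (MulAut H) where
  carrier := {ν | ν ∈ LieAut K EH H ∧ ν '' range X.ι = range X.ι}
  one_mem' := ⟨one_mem _, by simp⟩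
  mul_mem' {ν ν'} h h' := ⟨mul_mem h.1 h'.1, by
    rw [MulAut.coe_mul, image_comp, h'.2, h.2]⟩
  inv_mem' {ν} h := ⟨inv_mem h.1, by
    nth_rewrite 1 [← h.2]
    rw [← image_comp, ← MulAut.coe_mul, inv_mul_cancel]
    simp⟩

end LieGroupExtension

/-! ### Locality of smoothness, and homomorphisms smooth near the identity -/

section Smoothness

variable {K : Type*} [RCLike K]
variable {E : Type*} [AddCommGroup E] [Module K E] [TopologicalSpace E] [LocallyConvexTVS K E]
variable {F : Type*} [AddCommGroup F] [Module K F] [TopologicalSpace F] [LocallyConvexTVS K F]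

/-! A section `σ` of `q` identifies `H` with the set `N × G`, with a product given by the factor
system `(S, ω)`. An extension with kernel `[S]` has a section inducing `S` itself
(`HasKernel.exists_hasFactorSystem`), and the whole theorem is a comparison of such sections.

For one extension, the cocycles `ω` belonging to the fixed `S` form a single orbit under `d_S` of
central 1-cochains (`exists_d₁`, `d₁_mul`). For two extensions, cocycles belonging to the same `S`
differ by an element of `Z²_ss` (`exists_cocycle`). So extensions inducing `S` differ by a unique
class in `H²_ss`, and this class is trivial exactly when there is a common factor system
(`IsClassShift.unique`, `isClassShift_one_iff`). A common factor system yields an equivalence of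
extensions (`IsFactorSection.exists_equiv`).

For `p` in `Comp(S)`, the extension `p.X` again has a section inducing `S`, and `I(p)` is its
difference from `X`. An automorphism `ν` inducing `p` on `N` and `G` is the same thing as an
equivalence between `p.X` and `X`. Hence `p` lifts if and only if `I(p)` is trivial. If `ν` induces
the identity on both `N` and `G`, then `ν ∘ σ` and `σ` are sections inducing the same action, so
they differ by a central cochain, and multiplicativity of `ν` makes it a cocycle.

Sections are smooth only near `1`. This suffices for two reasons: homomorphisms smooth near `1` are
smooth, and maps into `N` may be tested for smoothness after composing with `ι`. -/

theorem MapSmoothOn.of_locally {M : Type*} [TopologicalSpace M] [ChartedSpace E M]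
    {P : Type*} [TopologicalSpace P] [ChartedSpace F P] {f : M → P} {U : Set M}
    (h : ∀ x ∈ U, ∃ V, IsOpen V ∧ x ∈ V ∧ V ⊆ U ∧ MapSmoothOn K E F f V) :
    MapSmoothOn K E F f U := by
  refine ⟨fun x hx => ?_, fun e he e' he' n => CnOn.of_locally fun x hx => ?_⟩
  · obtain ⟨V, hV, hxV, -, hf⟩ := h x hx
    exact (hf.1.continuousAt (hV.mem_nhds hxV)).continuousWithinAt
  · obtain ⟨V, hV, hxV, hVU, hf⟩ := h _ hx.2.1
    exact ⟨e.target ∩ e.symm ⁻¹' (V ∩ f ⁻¹' e'.source),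
      e.isOpen_inter_preimage_symm (hf.1.isOpen_inter_preimage hV e'.open_source),
      ⟨hx.1, hxV, hx.2.2⟩, fun y hy => ⟨hy.1, hVU hy.2.1, hy.2.2⟩, hf.2 e he e' he' n⟩

theorem MapSmoothOn.comp_univ {H : Type*} [AddCommGroup H] [Module K H] [TopologicalSpace H]
    [LocallyConvexTVS K H] {M : Type*} [TopologicalSpace M] [ChartedSpace E M]
    {P : Type*} [TopologicalSpace P] [ChartedSpace F P]
    {Q : Type*} [TopologicalSpace Q] [ChartedSpace H Q] {f : M → P} {g : P → Q}
    (hg : MapSmoothOn K F H g univ) (hf : MapSmoothOn K E F f univ) :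
    MapSmoothOn K E H (fun x => g (f x)) univ :=
  MapSmoothOn.comp isOpen_univ isOpen_univ (mapsTo_univ _ _) hg hf

/-- A group homomorphism that is smooth near the identity is smooth. -/
theorem MonoidHom.smooth_of_nearOne {M P : Type*} [Group M] [TopologicalSpace M]
    [ChartedSpace E M] [LCLieGroup K E M] [Group P] [TopologicalSpace P] [ChartedSpace F P]
    [LCLieGroup K F P] (f : M →* P) (hf : SmoothNearOne K E F f) :
    MapSmoothOn K E F f univ := by
  obtain ⟨U, hU, h1, hf⟩ := hf
  refine MapSmoothOn.of_locally fun x _ => ?_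
  have hm : MapSmoothOn K E E (fun y : M => x⁻¹ * y) univ :=
    MapSmoothOn.mul isOpen_univ (MapSmoothOn.const _ _) LCLieGroup.chart_smooth
  have hV : IsOpen ((fun y : M => x⁻¹ * y) ⁻¹' U) := by
    simpa using hm.1.isOpen_inter_preimage isOpen_univ hU
  refine ⟨_, hV, by simpa using h1, subset_univ _, ?_⟩
  -- Near `x`, `f` is the translate `y ↦ f(x) f(x⁻¹ y)` of its restriction to `U`.
  refine (MapSmoothOn.mul hV (MapSmoothOn.const (f x) _)
    (MapSmoothOn.comp hV hU (fun y hy => hy) hf (hm.mono (subset_univ _)))).congr hV ?_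
  intro y _
  simp

end Smoothness

namespace LieGroupExtension

variable {K EN EH EG N H G : Type*} [RCLike K]
  [AddCommGroup EN] [Module K EN] [TopologicalSpace EN] [LocallyConvexTVS K EN]
  [AddCommGroup EH] [Module K EH] [TopologicalSpace EH] [LocallyConvexTVS K EH]
  [AddCommGroup EG] [Module K EG] [TopologicalSpace EG] [LocallyConvexTVS K EG]
  [Group N] [TopologicalSpace N] [ChartedSpace EN N] [LCLieGroup K EN N]
  [Group H] [TopologicalSpace H] [ChartedSpace EH H] [LCLieGroup K EH H]
  [Group G] [TopologicalSpace G] [ChartedSpace EG G] [LCLieGroup K EG G]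

/-! ### Sections and factor systems of one extension -/

section Basic

variable (X : LieGroupExtension K EN EH EG N H G)

@[simp] theorem q_ι (n : N) : X.q (X.ι n) = 1 := by
  have h : X.ι n ∈ X.ι.range := ⟨n, rfl⟩
  rwa [X.range_eq_ker, MonoidHom.mem_ker] at h

theorem exists_ι_eq {y : H} (hy : X.q y = 1) : ∃ n, X.ι n = y := by
  have h : y ∈ X.q.ker := hy
  rwa [← X.range_eq_ker] at h

/-- `N` is an initial submanifold of `H`. -/
theorem smooth_of_comp_ι {E M : Type*} [AddCommGroup E] [Module K E] [TopologicalSpace E]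
    [LocallyConvexTVS K E] [TopologicalSpace M] [ChartedSpace E M] {f : M → N} {U : Set M}
    (hU : IsOpen U) (hf : MapSmoothOn K E EH (fun x => X.ι (f x)) U) :
    MapSmoothOn K E EN f U := by
  obtain ⟨V, hV, h1, s, r, -, hr, -, hsr⟩ := X.locally_trivial 1
  have hqV : IsOpen (X.q ⁻¹' V) := by
    simpa using X.q_smooth.1.isOpen_inter_preimage isOpen_univ hV
  -- Writing `1` and `ι(n)` in the trivialization gives `1 = s(1) ι(r(1))` and `ι(n) = s(1)
  -- ι(r(ι(n)))`, so `n = r(1)⁻¹ r(ι(n))` is recovered smoothly from `ι(n)`.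
  refine (MapSmoothOn.mul hU (MapSmoothOn.const (r 1)⁻¹ U)
    (MapSmoothOn.comp hU hqV (fun x _ => by simpa using h1) hr hf)).congr hU fun x _ => ?_
  apply X.ι_injective
  have e1 := hsr 1 (by simpa using h1)
  have e2 := hsr (X.ι (f x)) (by simpa using h1)
  rw [map_one] at e1
  rw [q_ι] at e2
  rw [map_mul, map_inv, ← eq_inv_of_mul_eq_one_left e1.symm]
  exact e2.symm

theorem smoothNearOne_of_comp_ι {E M : Type*} [AddCommGroup E] [Module K E] [TopologicalSpace E]
    [LocallyConvexTVS K E] [TopologicalSpace M] [ChartedSpace E M] [One M] {f : M → N}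
    (hf : SmoothNearOne K E EH (fun x => X.ι (f x))) : SmoothNearOne K E EN f := by
  obtain ⟨U, hU, h1, hf⟩ := hf
  exact ⟨U, hU, h1, X.smooth_of_comp_ι hU hf⟩

/-- The quotient `τ σ⁻¹` takes values in `ker q = ι(N)`, and its lift to `N` is smooth near `1`
because `N` is initial in `H`. Every comparison of two sections goes through this. -/
theorem exists_cochain {σ τ : G → H} (hσ : IsCochain₁ K EG EH σ) (hτ : IsCochain₁ K EG EH τ)
    (h : ∀ g, X.q (τ g) = X.q (σ g)) :
    ∃ f : G → N, IsCochain₁ K EG EN f ∧ ∀ g, X.ι (f g) = τ g * (σ g)⁻¹ := by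
  choose f hf using fun g => X.exists_ι_eq (y := τ g * (σ g)⁻¹) (by simp [h])
  refine ⟨f, ⟨X.ι_injective (by simp [hf, hσ.1, hτ.1]), X.smoothNearOne_of_comp_ι ?_⟩, hf⟩
  simpa only [hf] using hτ.2.mul hσ.2.inv

/-- `σ` is a normalized locally smooth section of `q` with factor system `(S, ω)`. -/
structure IsFactorSection (S : G → MulAut N) (ω : G × G → N) (σ : G → H) : Prop where
  cochain : IsCochain₁ K EG EH σ
  q_apply : ∀ g, X.q (σ g) = g
  act : ∀ g n, X.ι (S g n) = σ g * X.ι n * (σ g)⁻¹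
  cocycle : ∀ g g', X.ι (ω (g, g')) = σ g * σ g' * (σ (g * g'))⁻¹

variable {X} {S S' : G → MulAut N} {ω ω' : G × G → N} {σ : G → H}

theorem HasFactorSystem.exists_section (h : X.HasFactorSystem S ω) :
    ∃ σ, X.IsFactorSection S ω σ :=
  let ⟨σ, h1, h2, h3, h4⟩ := h
  ⟨σ, h1, h2, h3, h4⟩

/-- The factor system of the section `ι(h) σ`. -/
def shiftCocycle (S : G → MulAut N) (h : G → N) (ω : G × G → N) : G × G → N :=
  fun x => h x.1 * S x.1 (h x.2) * ω x * (h (x.1 * x.2))⁻¹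

theorem HasFactorSystem.shift (hX : X.HasFactorSystem S ω) {h : G → N}
    (hh : IsCochain₁ K EG EN h) :
    X.HasFactorSystem (fun g => MulAut.conj (h g) * S g) (shiftCocycle S h ω) := by
  obtain ⟨σ, hσ, hq, ha, hc⟩ := hX
  refine ⟨fun g => X.ι (h g) * σ g, ⟨by simp [hh.1, hσ.1], (hh.2.comp_left X.ι_smooth).mul hσ.2⟩,
    fun g => by simp [hq], fun g n => ?_, fun g g' => ?_⟩
  · simp [ha, mul_assoc]
  · simp [shiftCocycle, ha, hc, mul_assoc]

/-- The cochain is `h = τ σ⁻¹` for the two sections. Thus changing the section by `ι(h)` is the only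
freedom in the factor system of an extension. -/
theorem HasFactorSystem.exists_shift (hX : X.HasFactorSystem S ω)
    (hX' : X.HasFactorSystem S' ω') :
    ∃ h : G → N, IsCochain₁ K EG EN h ∧ (∀ g, S' g = MulAut.conj (h g) * S g) ∧
      ω' = shiftCocycle S h ω := by
  obtain ⟨σ, hσ, hq, ha, hc⟩ := hX
  obtain ⟨τ, hτ, hq', ha', hc'⟩ := hX'
  obtain ⟨h, hh, e⟩ := X.exists_cochain hσ hτ fun g => by rw [hq, hq']
  refine ⟨h, hh, fun g => ?_, ?_⟩
  · ext n
    apply X.ι_injective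
    simp [ha, ha', e, mul_assoc]
  · ext ⟨g, g'⟩
    apply X.ι_injective
    simp [shiftCocycle, ha, hc, hc', e, mul_assoc]

theorem HasFactorSystem.conj_eq (hX : X.HasFactorSystem S ω) (g g' : G) :
    S g * S g' = MulAut.conj (ω (g, g')) * S (g * g') := by
  obtain ⟨σ, hσ, hq, ha, hc⟩ := hX
  ext n
  apply X.ι_injective
  simp [ha, hc, mul_assoc]

/-- Associativity of the product `σ(g) σ(g') σ(g'')`. -/
theorem HasFactorSystem.cocycle_eq (hX : X.HasFactorSystem S ω) (g g' g'' : G) :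
    S g (ω (g', g'')) * ω (g, g' * g'') = ω (g, g') * ω (g * g', g'') := by
  obtain ⟨σ, hσ, hq, ha, hc⟩ := hX
  apply X.ι_injective
  simp [ha, hc, mul_assoc]

/-- The values `σ(g x)`, over which there is no smoothness control for `g` far from `1`, cancel:
`ω(g, x) ω(g x g⁻¹, g)⁻¹` becomes `σ(g) σ(x) σ(g)⁻¹ σ(g x g⁻¹)⁻¹` under `ι`. Here `σ` is evaluated
only near `1` and at the fixed point `g`. -/
theorem HasFactorSystem.isCochain₂ss (hX : X.HasFactorSystem S ω) :
    IsCochain₂ss K EG EN ω := by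
  obtain ⟨σ, hσ, hq, ha, hc⟩ := hX
  refine ⟨⟨fun g g' h => X.ι_injective ?_, X.smoothNearOne_of_comp_ι ?_⟩, fun g =>
    X.smoothNearOne_of_comp_ι ?_⟩
  · rcases h with rfl | rfl <;> simp [hc, hσ.1]
  · have h1 := hσ.2.comp_right (g := (Prod.fst : G × G → G))
      (MapSmoothOn.fst (H := EG) LCLieGroup.chart_smooth) rfl
    have h2 := hσ.2.comp_right (g := (Prod.snd : G × G → G))
      (MapSmoothOn.snd (F := EG) LCLieGroup.chart_smooth) rfl
    have h3 := hσ.2.comp_right (g := (fun p : G × G => p.1 * p.2)) LCLieGroup.mul_smooth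
      (mul_one 1)
    simpa only [← hc] using (h1.mul h2).mul h3.inv
  · have hm : MapSmoothOn K EG EG (fun x : G => g * x * g⁻¹) univ :=
      MapSmoothOn.mul isOpen_univ (MapSmoothOn.mul isOpen_univ (MapSmoothOn.const _ _)
        LCLieGroup.chart_smooth) (MapSmoothOn.const _ _)
    have h1 := hσ.2.comp_right hm (by simp)
    have h2 := (((SmoothNearOne.const (K := K) (E := EG) (F := EH) (M := G) (σ g)).mul hσ.2).mul
      (SmoothNearOne.const (σ g)⁻¹)).mul h1.inv
    convert h2 using 2 with x
    simp [hc, mul_assoc]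

/-- The section `σ ∘ ψ⁻¹` of `ψ ∘ q` does this. -/
theorem HasFactorSystem.twist (hX : X.HasFactorSystem S ω)
    (p : LieAut K EN N × LieAut K EG G) :
    (X.twist p).HasFactorSystem (pairAct p S) (fun x => (p.1 : MulAut N)
      (ω ((p.2 : MulAut G)⁻¹ x.1, (p.2 : MulAut G)⁻¹ x.2))) := by
  obtain ⟨σ, hσ, hq, ha, hc⟩ := hX
  refine ⟨fun g => σ ((p.2 : MulAut G)⁻¹ g), ⟨by simp [hσ.1],
    hσ.2.comp_right (p.2⁻¹).2.1 (map_one _)⟩, fun g => ?_, fun g n => ?_, fun g g' => ?_⟩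
  · simp [LieGroupExtension.twist, hq]
  · simp [LieGroupExtension.twist, pairAct, ha]
  · simp [LieGroupExtension.twist, hc]

end Basic

/-! ### Extensions with a common factor system -/

section Equivalence

variable {EH' H' : Type*}
  [AddCommGroup EH'] [Module K EH'] [TopologicalSpace EH'] [LocallyConvexTVS K EH']
  [Group H'] [TopologicalSpace H'] [ChartedSpace EH' H'] [LCLieGroup K EH' H']
  {X : LieGroupExtension K EN EH EG N H G} {X' : LieGroupExtension K EN EH' EG N H' G}
  {S : G → MulAut N} {ω : G × G → N} {σ : G → H} {σ' : G → H'}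

/-- Each element of `H` is uniquely `ι(n) σ(g)`, and in these coordinates the product depends only
on `(S, ω)`. Matching coordinates is therefore multiplicative. It is smooth near `1`, where both
sections are, hence everywhere. -/
theorem IsFactorSection.exists_hom (h : X.IsFactorSection S ω σ)
    (h' : X'.IsFactorSection S ω σ') :
    ∃ f : H →* H', MapSmoothOn K EH EH' f univ ∧
      ∀ n g, f (X.ι n * σ g) = X'.ι n * σ' g := by
  choose ρ hρ using fun y : H => X.exists_ι_eq (y := y * (σ (X.q y))⁻¹) (by simp [h.q_apply])
  have hρ' : ∀ n g, ρ (X.ι n * σ g) = n := fun n g => X.ι_injective (by simp [hρ, h.q_apply])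
  have hmul : ∀ y z, ρ (y * z) = ρ y * S (X.q y) (ρ z) * ω (X.q y, X.q z) := fun y z =>
    X.ι_injective (by simp [hρ, h.act, h.cocycle, mul_assoc])
  refine ⟨MonoidHom.mk' (fun y => X'.ι (ρ y) * σ' (X.q y)) fun y z => ?_, ?_, fun n g => ?_⟩
  · simp [hmul, h'.act, h'.cocycle, mul_assoc]
  · refine MonoidHom.smooth_of_nearOne _ ?_
    have hs := h.cochain.2.comp_right X.q_smooth (map_one _)
    have hs' := h'.cochain.2.comp_right X.q_smooth (map_one _)
    have hid : SmoothNearOne K EH EH (fun y : H => y) :=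
      ⟨univ, isOpen_univ, mem_univ _, LCLieGroup.chart_smooth⟩
    have hr : SmoothNearOne K EH EN ρ := X.smoothNearOne_of_comp_ι (by
      simpa only [hρ] using hid.mul hs.inv)
    exact (hr.comp_left X'.ι_smooth).mul hs'
  · simp [hρ', h.q_apply]

theorem IsFactorSection.exists_eq (h : X.IsFactorSection S ω σ) (y : H) :
    ∃ n g, y = X.ι n * σ g := by
  obtain ⟨n, hn⟩ := X.exists_ι_eq (y := y * (σ (X.q y))⁻¹) (by simp [h.q_apply])
  exact ⟨n, X.q y, by simp [hn]⟩

/-- Extensions with a common factor system are equivalent. -/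
theorem IsFactorSection.exists_equiv (h : X.IsFactorSection S ω σ)
    (h' : X'.IsFactorSection S ω σ') :
    ∃ f : H ≃* H', MapSmoothOn K EH EH' f univ ∧ MapSmoothOn K EH' EH f.symm univ ∧
      (∀ n, f (X.ι n) = X'.ι n) ∧ ∀ y, X'.q (f y) = X.q y := by
  obtain ⟨f, hf, e⟩ := h.exists_hom h'
  obtain ⟨f', hf', e'⟩ := h'.exists_hom h
  refine ⟨MonoidHom.toMulEquiv f f' ?_ ?_, hf, hf', fun n => ?_, fun y => ?_⟩
  · ext y
    obtain ⟨n, g, rfl⟩ := h.exists_eq y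
    rw [MonoidHom.comp_apply, e, e']
    rfl
  · ext y
    obtain ⟨n, g, rfl⟩ := h'.exists_eq y
    rw [MonoidHom.comp_apply, e', e]
    rfl
  · simpa [h.cochain.1, h'.cochain.1] using e n 1
  · obtain ⟨n, g, rfl⟩ := h.exists_eq y
    show X'.q (f _) = _
    rw [e]
    simp [h.q_apply, h'.q_apply]

end Equivalence

end LieGroupExtension

namespace LieGroupExtension

variable {K EN EH EG N H G : Type*} [RCLike K]
  [AddCommGroup EN] [Module K EN] [TopologicalSpace EN] [LocallyConvexTVS K EN]
  [AddCommGroup EH] [Module K EH] [TopologicalSpace EH] [LocallyConvexTVS K EH]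
  [AddCommGroup EG] [Module K EG] [TopologicalSpace EG] [LocallyConvexTVS K EG]
  [Group N] [TopologicalSpace N] [ChartedSpace EN N] [LCLieGroup K EN N]
  [Group H] [TopologicalSpace H] [ChartedSpace EH H] [LCLieGroup K EH H]
  [Group G] [TopologicalSpace G] [ChartedSpace EG G] [LCLieGroup K EG G]

theorem mem_center_of_conj_eq_one {n : N} (h : MulAut.conj n = 1) : n ∈ Subgroup.center N := by
  rw [Subgroup.mem_center_iff]
  intro m
  have := DFunLike.congr_fun h m
  rw [MulAut.conj_apply, MulAut.one_apply, mul_inv_eq_iff_eq_mul] at this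
  exact this.symm

/-! ### Central cocycles and the class of an extension relative to `S` -/

section Cohomology

variable {S : SmoothOuterAction K EG EN G N}

/-- If `S' = (C_N ∘ h) · S`, multiplying the section by `ι(h)⁻¹` makes it induce `S` on the nose. -/
theorem HasKernel.exists_hasFactorSystem {X : LieGroupExtension K EN EH EG N H G}
    (hX : X.HasKernel S) : ∃ ω, X.HasFactorSystem S.toFun ω := by
  obtain ⟨S', ω', hX, h, hh, e⟩ := hX
  refine ⟨shiftCocycle S' (fun g => (h g)⁻¹) ω', ?_⟩
  have := hX.shift (h := fun g => (h g)⁻¹) ⟨by simp [hh.1], hh.2.inv⟩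
  convert this using 2 with g
  simp [e]

/-- Central factors move past `ω`. This is why `B²_s` is the right group to divide by: it records
changes of section that leave `S` fixed. -/
theorem shiftCocycle_central (z : G → Subgroup.center N) (ω : G × G → N) :
    shiftCocycle S.toFun (fun g => (z g : N)) ω = fun x => (S.d₁ z x : N) * ω x := by
  have aux : ∀ (a b c : Subgroup.center N) (w : N),
      (a : N) * b * w * (c : N)⁻¹ = (b * c⁻¹ * a : Subgroup.center N) * w := by
    intro a b c w
    have hc := Subgroup.mem_center_iff.1 (c⁻¹).2
    rw [mul_comm (b * c⁻¹) a, ← mul_assoc]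
    push_cast at hc ⊢
    rw [mul_assoc _ w, hc, ← mul_assoc]
  ext x
  exact aux (z x.1) (S.centerAct x.1 (z x.2)) (z (x.1 * x.2)) (ω x)

theorem HasFactorSystem.d₁_mul {X : LieGroupExtension K EN EH EG N H G} {ω : G × G → N}
    (hX : X.HasFactorSystem S.toFun ω) {z : G → Subgroup.center N}
    (hz : z ∈ CentralC₁ K EG EN G N) :
    X.HasFactorSystem S.toFun (fun x => (S.d₁ z x : N) * ω x) := by
  rw [← shiftCocycle_central]
  convert hX.shift (h := fun g => (z g : N)) hz using 2 with g
  ext n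
  have := Subgroup.mem_center_iff.1 (z g).2 (S.toFun g n)
  simp [← this]

/-- Both sections induce `S`, so conjugation by `h(g)` is trivial and the comparing cochain `h` is
central. -/
theorem HasFactorSystem.exists_d₁ {X : LieGroupExtension K EN EH EG N H G} {ω ω' : G × G → N}
    (hX : X.HasFactorSystem S.toFun ω) (hX' : X.HasFactorSystem S.toFun ω') :
    ∃ z ∈ CentralC₁ K EG EN G N, ω' = fun x => (S.d₁ z x : N) * ω x := by
  obtain ⟨h, hh, e, rfl⟩ := hX.exists_shift hX'
  have hc : ∀ g, h g ∈ Subgroup.center N := fun g =>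
    mem_center_of_conj_eq_one (by simpa using e g)
  exact ⟨fun g => ⟨h g, hc g⟩, hh, shiftCocycle_central (S := S) (fun g => ⟨h g, hc g⟩) ω⟩

variable {EH' H' : Type*}
  [AddCommGroup EH'] [Module K EH'] [TopologicalSpace EH'] [LocallyConvexTVS K EH']
  [Group H'] [TopologicalSpace H'] [ChartedSpace EH' H'] [LCLieGroup K EH' H']
  {X : LieGroupExtension K EN EH EG N H G} {X' : LieGroupExtension K EN EH' EG N H' G}

/-- Extensions inducing the same outer action differ by a central cocycle. -/
theorem HasFactorSystem.exists_cocycle {ω ω' : G × G → N} (hX : X.HasFactorSystem S.toFun ω)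
    (hX' : X'.HasFactorSystem S.toFun ω') :
    ∃ β : S.Z₂ss, ω' = fun x => ((β : G × G → Subgroup.center N) x : N) * ω x := by
  -- Both `ω(g, g')` and `ω'(g, g')` conjugate `N` by `S(g) S(g') S(g g')⁻¹`.
  have hc : ∀ x, ω' x * (ω x)⁻¹ ∈ Subgroup.center N := by
    rintro ⟨g, g'⟩
    apply mem_center_of_conj_eq_one
    have := (hX.conj_eq g g').symm.trans (hX'.conj_eq g g')
    rw [map_mul, map_inv, mul_inv_eq_one]
    exact (mul_right_cancel this).symm
  have hss := hX.isCochain₂ss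
  have hss' := hX'.isCochain₂ss
  set β : G × G → Subgroup.center N := fun x => ⟨ω' x * (ω x)⁻¹, hc x⟩ with hβ
  have hω : ∀ x, ω' x = β x * ω x := fun x => by simp [hβ]
  have hcomm : ∀ (x : G × G) (n : N), n * (β x : N) = β x * n := fun x =>
    Subgroup.mem_center_iff.1 (β x).2
  refine ⟨⟨β, ⟨⟨fun g g' h => ?_, hss'.1.2.mul hss.1.2.inv⟩, fun g => ?_⟩, ?_⟩, funext hω⟩
  · simp [hβ, hss.1.1 g g' h, hss'.1.1 g g' h]
  · convert (hss'.2 g).mul (hss.2 g).inv using 2 with x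
    rw [hω, hω]
    -- With `a = β(g, x)` and `b = β(g x g⁻¹, g)`, centrality of `b` splits the `ss`-expression of
    -- `β` into that of `ω'` times the inverse of that of `ω`.
    have aux : ∀ a b u v : N, (∀ n, n * b⁻¹ = b⁻¹ * n) →
        a * b⁻¹ = a * u * (b * v)⁻¹ * (u * v⁻¹)⁻¹ := by
      intro a b u v hb
      rw [mul_inv_rev, hb v⁻¹, mul_inv_rev, inv_inv]
      simp only [mul_assoc]
      rw [inv_mul_cancel_left, ← mul_assoc u, hb u, mul_inv_cancel_right]
    exact aux _ _ _ _ (Subgroup.mem_center_iff.1 (β (g * x * g⁻¹, g))⁻¹.2)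
  · show S.d₂ β = 1
    ext ⟨g, g', g''⟩
    -- Substituting `ω' = β ω` into its cocycle identity, collecting the central factors and
    -- cancelling the identity for `ω` leaves `d_S β = 1`.
    have e := hX.cocycle_eq g g' g''
    have e' := hX'.cocycle_eq g g' g''
    simp only [hω, map_mul] at e'
    have hS : ∀ n : N, n * S.toFun g (β (g', g'')) = S.toFun g (β (g', g'')) * n :=
      Subgroup.mem_center_iff.1 (S.centerAct g (β (g', g''))).2
    have l : S.toFun g (β (g', g'')) * S.toFun g (ω (g', g'')) *
        (β (g, g' * g'') * ω (g, g' * g'')) = S.toFun g (β (g', g'')) * β (g, g' * g'') *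
          (S.toFun g (ω (g', g'')) * ω (g, g' * g'')) := by
      rw [mul_assoc, ← mul_assoc _ (β (g, g' * g'') : N), hcomm]
      simp only [mul_assoc]
    have r : β (g, g') * ω (g, g') * (β (g * g', g'') * ω (g * g', g'')) =
        β (g, g') * β (g * g', g'') * (ω (g, g') * ω (g * g', g'')) := by
      rw [mul_assoc, ← mul_assoc _ (β (g * g', g'') : N), hcomm]
      simp only [mul_assoc]
    rw [l, r, e] at e'
    have key : S.centerAct g (β (g', g'')) * β (g, g' * g'') = β (g, g') * β (g * g', g'') :=
      Subtype.ext (mul_right_cancel e')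
    refine congrArg Subtype.val (?_ : S.centerAct g (β (g', g'')) * (β (g * g', g''))⁻¹ *
      β (g, g' * g'') * (β (g, g'))⁻¹ = 1)
    rw [mul_right_comm _ _ (β (g, g' * g'')), key]
    simp

/-- The two choices of factor system are linked by `d_S z` on the side of `X` and by `d_S z'` on the
side of `X'`. Comparing them gives `β' · d_S z = d_S z' · β`, so `β⁻¹ β' = d_S (z⁻¹ z')`. -/
theorem IsClassShift.unique {c c' : S.H₂ss} (h : IsClassShift S c X X')
    (h' : IsClassShift S c' X X') : c = c' := by
  obtain ⟨β, ω, rfl, hX, hX'⟩ := h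
  obtain ⟨β', ω', rfl, hY, hY'⟩ := h'
  obtain ⟨z, hz, rfl⟩ := hX.exists_d₁ hY
  obtain ⟨z', hz', e⟩ := hX'.exists_d₁ hY'
  rw [QuotientGroup.eq]
  refine ⟨z⁻¹ * z', mul_mem (inv_mem hz) hz', ?_⟩
  rw [map_mul, map_inv]
  ext1 x
  have e := congrFun e x
  simp only [← mul_assoc] at e
  have e : (β' : G × G → Subgroup.center N) x * S.d₁ z x =
      S.d₁ z' x * (β : G × G → Subgroup.center N) x := Subtype.ext (mul_right_cancel e)
  show (S.d₁ z x)⁻¹ * S.d₁ z' x = ((β : G × G → Subgroup.center N) x)⁻¹ *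
    (β' : G × G → Subgroup.center N) x
  rw [inv_mul_eq_iff_eq_mul, mul_left_comm, eq_inv_mul_iff_mul_eq, mul_comm (S.d₁ z x), e,
    mul_comm]

/-- A coboundary `β = d_S z` is absorbed by replacing the section `σ` of `X` by `ι(z) σ`. -/
theorem isClassShift_one_iff : IsClassShift S 1 X X' ↔
    ∃ ω, X.HasFactorSystem S.toFun ω ∧ X'.HasFactorSystem S.toFun ω := by
  constructor
  · rintro ⟨β, ω, h1, hX, hX'⟩
    obtain ⟨z, hz, e⟩ := (QuotientGroup.eq_one_iff _).1 h1
    have e : S.d₁ z = (β : G × G → Subgroup.center N) := e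
    rw [← e] at hX'
    exact ⟨_, hX.d₁_mul hz, hX'⟩
  · rintro ⟨ω, hX, hX'⟩
    exact ⟨1, ω, rfl, hX, by simpa using hX'⟩

/-- The twisted section induces `p.S`, and the cochain `h` witnessing `p.S ∼ S` corrects it to one
that induces `S` again. -/
theorem HasFactorSystem.shift_twist {p : LieAut K EN N × LieAut K EG G} {ω : G × G → N}
    (hX : X.HasFactorSystem S.toFun ω) {h : G → N} (hh : IsCochain₁ K EG EN h)
    (e : ∀ g, S.toFun g = MulAut.conj (h g) * pairAct p S.toFun g) :
    (X.twist p).HasFactorSystem S.toFun (shiftCocycle (pairAct p S.toFun) h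
      (fun x => (p.1 : MulAut N) (ω ((p.2 : MulAut G)⁻¹ x.1, (p.2 : MulAut G)⁻¹ x.2)))) := by
  convert (hX.twist p).shift hh using 2 with g
  exact e g

/-- Used to carry a central cocycle unchanged through the correction by `h`, so that it can be split
off in the proof of the cocycle identity for `I`. -/
theorem shiftCocycle_mul_central (T : G → MulAut N) (h : G → N) (b : G × G → Subgroup.center N)
    (ω : G × G → N) : shiftCocycle T h (fun x => (b x : N) * ω x) =
      fun x => (b x : N) * shiftCocycle T h ω x := by
  ext x
  have := Subgroup.mem_center_iff.1 (b x).2 (h x.1 * T x.1 (h x.2))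
  simp only [shiftCocycle, ← mul_assoc, this]

theorem HasFactorSystem.twist_mul {p p' : LieAut K EN N × LieAut K EG G} {T : G → MulAut N}
    {ω : G × G → N} (h : ((X.twist p').twist p).HasFactorSystem T ω) :
    (X.twist (p * p')).HasFactorSystem T ω := by
  obtain ⟨σ, h1, h2, h3, h4⟩ := h
  refine ⟨σ, h1, h2, fun g n => ?_, fun g g' => ?_⟩
  · simpa [LieGroupExtension.twist] using h3 g n
  · simpa [LieGroupExtension.twist] using h4 g g'

end Cohomology

end LieGroupExtension

namespace LieGroupExtension

variable {K EN EH EG N H G : Type*} [RCLike K]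
  [AddCommGroup EN] [Module K EN] [TopologicalSpace EN] [LocallyConvexTVS K EN]
  [AddCommGroup EH] [Module K EH] [TopologicalSpace EH] [LocallyConvexTVS K EH]
  [AddCommGroup EG] [Module K EG] [TopologicalSpace EG] [LocallyConvexTVS K EG]
  [Group N] [TopologicalSpace N] [ChartedSpace EN N] [LCLieGroup K EN N]
  [Group H] [TopologicalSpace H] [ChartedSpace EH H] [LCLieGroup K EH H]
  [Group G] [TopologicalSpace G] [ChartedSpace EG G] [LCLieGroup K EG G]
  {S : SmoothOuterAction K EG EN G N} {X : LieGroupExtension K EN EH EG N H G}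

/-! ### Automorphisms given by central cocycles -/

section Central

/-- In `x = ι(n) σ(g)` the factor `ι(n)` commutes with `ι(Z(N))`, so only `σ(g)` acts. -/
theorem HasFactorSystem.conj_central {ω : G × G → N} (hX : X.HasFactorSystem S.toFun ω) (x : H)
    (z : Subgroup.center N) : x * X.ι z * x⁻¹ = X.ι (S.centerAct (X.q x) z) := by
  obtain ⟨σ, hσ⟩ := hX.exists_section
  obtain ⟨n, g, rfl⟩ := hσ.exists_eq x
  have hn := Subgroup.mem_center_iff.1 (S.centerAct g z).2 n
  have e : σ g * X.ι z * (σ g)⁻¹ = X.ι (S.centerAct g z) := (hσ.act g z).symm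
  calc X.ι n * σ g * X.ι z * (X.ι n * σ g)⁻¹
      = X.ι n * (σ g * X.ι z * (σ g)⁻¹) * (X.ι n)⁻¹ := by simp [mul_assoc]
    _ = _ := by rw [e, ← map_mul, hn]; simp [hσ.q_apply]

/-- The endomorphism `x ↦ ι(f(q(x))) x` for a cocycle `f`. -/
def cocycleHom (X : LieGroupExtension K EN EH EG N H G) (hX : X.HasKernel S) (f : S.Z₁) :
    H →* H :=
  MonoidHom.mk' (fun x => X.ι (f.1 (X.q x)) * x) fun x y => by
    obtain ⟨ω, hω⟩ := hX.exists_hasFactorSystem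
    have hd : S.centerAct (X.q x) (f.1 (X.q y)) * (f.1 (X.q x * X.q y))⁻¹ * f.1 (X.q x) = 1 :=
      congrFun f.2.2 (X.q x, X.q y)
    -- The cocycle condition as a crossed homomorphism. Since `q x` acts on the centre as
    -- conjugation by `x`, this is exactly multiplicativity of `x ↦ ι(f(q x)) x`.
    have hf : f.1 (X.q x * X.q y) = f.1 (X.q x) * S.centerAct (X.q x) (f.1 (X.q y)) := by
      rw [mul_right_comm, mul_inv_eq_one] at hd
      rw [← hd, mul_comm]
    rw [map_mul, hf, Subgroup.coe_mul, map_mul, ← hω.conj_central]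
    simp [mul_assoc]

theorem cocycleHom_smooth (hX : X.HasKernel S) (f : S.Z₁) :
    MapSmoothOn K EH EH (X.cocycleHom hX f) univ := by
  refine MonoidHom.smooth_of_nearOne _ ?_
  have h1 : SmoothNearOne K EG EN (fun g => (f.1 g : N)) := f.2.1.2
  exact ((h1.comp_right X.q_smooth (map_one _)).comp_left X.ι_smooth).mul
    ⟨univ, isOpen_univ, mem_univ _, LCLieGroup.chart_smooth⟩

theorem cocycleHom_mul (hX : X.HasKernel S) (f f' : S.Z₁) (x : H) :
    X.cocycleHom hX (f * f') x = X.cocycleHom hX f (X.cocycleHom hX f' x) := by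
  simp [cocycleHom, mul_assoc]

theorem cocycleHom_one (hX : X.HasKernel S) (x : H) : X.cocycleHom hX 1 x = x := by
  simp [cocycleHom]

/-- `cocycleHom` as an automorphism of `H`. -/
def cocycleEquiv (X : LieGroupExtension K EN EH EG N H G) (hX : X.HasKernel S) (f : S.Z₁) :
    MulAut H :=
  MonoidHom.toMulEquiv (X.cocycleHom hX f) (X.cocycleHom hX f⁻¹)
    (by ext x; simp [← cocycleHom_mul, cocycleHom_one])
    (by ext x; simp [← cocycleHom_mul, cocycleHom_one])

theorem cocycleEquiv_apply (hX : X.HasKernel S) (f : S.Z₁) (x : H) :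
    X.cocycleEquiv hX f x = X.ι (f.1 (X.q x)) * x := rfl

theorem mem_Z₁_apply_one {f : G → Subgroup.center N} (hf : f ∈ S.Z₁) : f 1 = 1 :=
  Subtype.ext hf.1.1

theorem cocycleEquiv_ι (hX : X.HasKernel S) (f : S.Z₁) (n : N) :
    X.cocycleEquiv hX f (X.ι n) = X.ι n := by
  simp [cocycleEquiv_apply, mem_Z₁_apply_one f.2]

/-- The homomorphism `Ψ : Z¹_s(G, Z(N))_S → Aut(H, N)`. -/
def ofCocycle (X : LieGroupExtension K EN EH EG N H G) (hX : X.HasKernel S) : S.Z₁ →* X.Aut :=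
  MonoidHom.mk' (fun f => ⟨X.cocycleEquiv hX f,
    ⟨X.cocycleHom_smooth hX f, X.cocycleHom_smooth hX f⁻¹⟩, by
      rw [← range_comp]
      exact congrArg range (funext (X.cocycleEquiv_ι hX f))⟩)
    fun f f' => Subtype.ext (MulEquiv.ext (X.cocycleHom_mul hX f f'))

theorem ofCocycle_apply (hX : X.HasKernel S) (f : S.Z₁) (x : H) :
    (X.ofCocycle hX f : MulAut H) x = X.ι (f.1 (X.q x)) * x := rfl

theorem ofCocycle_injective (hX : X.HasKernel S) : Function.Injective (X.ofCocycle hX) := by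
  intro f f' h
  ext g
  obtain ⟨x, rfl⟩ := X.q_surjective g
  have : X.ι (f.1 (X.q x)) * x = X.ι (f'.1 (X.q x)) * x :=
    congrArg (fun ν : X.Aut => (ν : MulAut H) x) h
  exact X.ι_injective (mul_right_cancel this)

/-- An automorphism inducing the identity on `N` and on `G` is given by a cocycle. -/
theorem exists_ofCocycle_eq (hX : X.HasKernel S) (ν : X.Aut)
    (hN : ∀ n, (ν : MulAut H) (X.ι n) = X.ι n) (hG : ∀ x, X.q ((ν : MulAut H) x) = X.q x) :
    ∃ f, X.ofCocycle hX f = ν := by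
  obtain ⟨ω, hω⟩ := hX.exists_hasFactorSystem
  obtain ⟨σ, hσ⟩ := hω.exists_section
  -- As `ν` is trivial on `G`, `ν ∘ σ` is again a section; write it as `ι(h) σ`.
  obtain ⟨h, hh, e⟩ := X.exists_cochain hσ.cochain
    (τ := fun g => (ν : MulAut H) (σ g))
    ⟨by simp [hσ.cochain.1], hσ.cochain.2.comp_left (g := (ν : MulAut H)) ν.2.1.1⟩
    fun g => hG _
  have e' : ∀ g, (ν : MulAut H) (σ g) = X.ι (h g) * σ g := fun g => by simp [e]
  -- Since `ν` fixes `ι(N)`, the sections `σ` and `ι(h) σ` conjugate it alike. So `h(g)` commutes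
  -- with all `S(g)(m)`, and these exhaust `N`.
  have hc : ∀ g, h g ∈ Subgroup.center N := by
    intro g
    rw [Subgroup.mem_center_iff]
    intro n
    obtain ⟨m, rfl⟩ := (S.toFun g).surjective n
    have := hN (S.toFun g m)
    rw [hσ.act, map_mul, map_mul, map_inv, hN, e', mul_inv_rev] at this
    apply X.ι_injective
    rw [map_mul, map_mul, hσ.act]
    nth_rewrite 1 [← this]
    simp [mul_assoc]
  have hν : ∀ n g, (ν : MulAut H) (X.ι n * σ g) = X.ι (h g) * (X.ι n * σ g) := by
    intro n g
    rw [map_mul, hN, e', ← mul_assoc, ← map_mul, Subgroup.mem_center_iff.1 (hc g) n, map_mul,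
      mul_assoc]
  set f : G → Subgroup.center N := fun g => ⟨h g, hc g⟩ with hf
  have hνf : ∀ x, (ν : MulAut H) x = X.ι (f (X.q x)) * x := by
    intro x
    obtain ⟨n, g, rfl⟩ := hσ.exists_eq x
    rw [hν]
    simp [hf, hσ.q_apply]
  refine ⟨⟨f, hh, ?_⟩, Subtype.ext (MulEquiv.ext fun x => (hνf x).symm)⟩
  show S.d₁ f = 1
  ext1 ⟨g, g'⟩
  -- Computing `ν(σ(g) σ(g'))` in two ways gives the crossed homomorphism property `h3`.
  have h1 := map_mul (ν : MulAut H) (σ g) (σ g')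
  simp only [hνf, map_mul, hσ.q_apply] at h1
  have h2 := hω.conj_central (σ g) (f g')
  rw [hσ.q_apply] at h2
  have h3 : f (g * g') = f g * S.centerAct g (f g') := by
    apply Subtype.ext
    apply X.ι_injective
    rw [Subgroup.coe_mul, map_mul, ← h2]
    rw [← eq_mul_inv_iff_mul_eq] at h1
    rw [h1]
    simp [mul_assoc]
  show S.centerAct g (f g') * (f (g * g'))⁻¹ * f g = 1
  rw [h3, mul_right_comm, mul_comm (f g), mul_inv_cancel]

end Central

/-! ### Induced automorphisms of `N` and `G`, and lifting them back -/

section Induced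

theorem exists_restrict (ν : X.Aut) :
    ∃ φ : N →* N, MapSmoothOn K EN EN φ univ ∧ ∀ n, X.ι (φ n) = (ν : MulAut H) (X.ι n) := by
  have h : ∀ n, ∃ m, X.ι m = (ν : MulAut H) (X.ι n) := fun n => by
    have h1 : (ν : MulAut H) (X.ι n) ∈ (ν : MulAut H) '' range X.ι := ⟨_, ⟨n, rfl⟩, rfl⟩
    rwa [ν.2.2] at h1
  choose φ hφ using h
  refine ⟨MonoidHom.mk' φ fun n m => X.ι_injective (by simp [hφ]),
    X.smooth_of_comp_ι isOpen_univ ?_, hφ⟩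
  simp only [MonoidHom.mk'_apply, hφ]
  exact MapSmoothOn.comp_univ (g := (ν : MulAut H)) ν.2.1.1 X.ι_smooth

/-- `ν` preserves `ι(N) = ker q`, so it descends. The induced map is smooth near `1`, where it
equals `q ∘ ν ∘ s` for a local section `s`. -/
theorem exists_quotient (ν : X.Aut) :
    ∃ ψ : G →* G, MapSmoothOn K EG EG ψ univ ∧ ∀ x, ψ (X.q x) = X.q ((ν : MulAut H) x) := by
  obtain ⟨φ, -, hφ⟩ := X.exists_restrict ν
  have hker : X.q.ker ≤ (X.q.comp (ν : MulAut H).toMonoidHom).ker := fun x hx => by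
    obtain ⟨n, rfl⟩ := X.exists_ι_eq hx
    show X.q ((ν : MulAut H) (X.ι n)) = 1
    rw [← hφ, q_ι]
  set ψ := X.q.liftOfSurjective X.q_surjective ⟨_, hker⟩ with hψ
  have e : ∀ x, ψ (X.q x) = X.q ((ν : MulAut H) x) := fun x =>
    MonoidHom.liftOfRightInverse_comp_apply _ _ _ ⟨_, hker⟩ x
  refine ⟨ψ, MonoidHom.smooth_of_nearOne _ ?_, e⟩
  obtain ⟨U, hU, h1, s, -, hs, -, hqs, -⟩ := X.locally_trivial 1
  refine ⟨U, hU, h1, (MapSmoothOn.comp hU isOpen_univ (mapsTo_univ _ _)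
    (MapSmoothOn.comp_univ (f := (ν : MulAut H)) X.q_smooth ν.2.1.1) hs).congr hU fun x hx => ?_⟩
  rw [← e, hqs x hx]

theorem exists_restrictAut (ν : X.Aut) :
    ∃ φ : LieAut K EN N, ∀ n, X.ι ((φ : MulAut N) n) = (ν : MulAut H) (X.ι n) := by
  obtain ⟨φ, hφ, e⟩ := X.exists_restrict ν
  obtain ⟨φ', hφ', e'⟩ := X.exists_restrict ν⁻¹
  refine ⟨⟨MonoidHom.toMulEquiv φ φ' ?_ ?_, hφ, hφ'⟩, e⟩ <;> ext n <;> apply X.ι_injective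
  · simp [e, e']
  · simp [e, e']

theorem exists_quotientAut (ν : X.Aut) :
    ∃ ψ : LieAut K EG G, ∀ x, (ψ : MulAut G) (X.q x) = X.q ((ν : MulAut H) x) := by
  obtain ⟨ψ, hψ, e⟩ := X.exists_quotient ν
  obtain ⟨ψ', hψ', e'⟩ := X.exists_quotient ν⁻¹
  refine ⟨⟨MonoidHom.toMulEquiv ψ ψ' ?_ ?_, hψ, hψ'⟩, e⟩ <;> ext g <;>
    obtain ⟨x, rfl⟩ := X.q_surjective g
  · simp [e, e']
  · simp [e, e']

/-- `ν⁻¹ ∘ σ` is a section of `ψ ∘ q`, and applying `ν⁻¹` to the equations that define the factor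
system of `σ` gives the same `(T, ω)` relative to `ι ∘ φ⁻¹` and `ψ ∘ q`. -/
theorem HasFactorSystem.twist_of_aut {T : G → MulAut N} {ω : G × G → N}
    (hX : X.HasFactorSystem T ω) (ν : X.Aut) {p : LieAut K EN N × LieAut K EG G}
    (hN : ∀ n, X.ι ((p.1 : MulAut N) n) = (ν : MulAut H) (X.ι n))
    (hG : ∀ x, (p.2 : MulAut G) (X.q x) = X.q ((ν : MulAut H) x)) :
    (X.twist p).HasFactorSystem T ω := by
  obtain ⟨σ, hσ, hq, ha, hc⟩ := hX
  have hN' : ∀ n, X.ι ((p.1 : MulAut N)⁻¹ n) = (ν : MulAut H)⁻¹ (X.ι n) := fun n => by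
    apply (ν : MulAut H).injective
    rw [← hN, MulAut.apply_inv_self, MulAut.apply_inv_self]
  refine ⟨fun g => (ν : MulAut H)⁻¹ (σ g), ⟨by simp [hσ.1],
    hσ.2.comp_left (g := ((ν : MulAut H)⁻¹ : MulAut H)) (inv_mem ν.2.1).1⟩, fun g => ?_,
    fun g n => ?_, fun g g' => ?_⟩
  · show (p.2 : MulAut G) (X.q _) = g
    rw [hG, MulAut.apply_inv_self, hq]
  · show X.ι ((p.1 : MulAut N)⁻¹ _) = _ * X.ι ((p.1 : MulAut N)⁻¹ n) * _
    simp only [hN', ha, map_mul, map_inv]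
  · show X.ι ((p.1 : MulAut N)⁻¹ _) = _
    simp only [hN', hc, map_mul, map_inv]

/-- The extension twisted by `(φ, ψ)` has one section inducing `(φ, ψ).S`, by transport, and one
inducing `S`, by `HasFactorSystem.twist_of_aut`. Comparing them yields `(φ, ψ).S ∼ S`. -/
theorem exists_comp (hX : X.HasKernel S) (ν : X.Aut) :
    ∃ p : S.Comp, (∀ n, X.ι ((p.1.1 : MulAut N) n) = (ν : MulAut H) (X.ι n)) ∧
      ∀ x, (p.1.2 : MulAut G) (X.q x) = X.q ((ν : MulAut H) x) := by
  obtain ⟨φ, hφ⟩ := X.exists_restrictAut ν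
  obtain ⟨ψ, hψ⟩ := X.exists_quotientAut ν
  obtain ⟨ω, hω⟩ := hX.exists_hasFactorSystem
  obtain ⟨h, hh, e, -⟩ := (hω.twist (φ, ψ)).exists_shift
    (hω.twist_of_aut ν (p := (φ, ψ)) hφ hψ)
  exact ⟨⟨(φ, ψ), h, hh, e⟩, hφ, hψ⟩

theorem comp_ext {p p' : S.Comp}
    (hN : ∀ n, X.ι ((p.1.1 : MulAut N) n) = X.ι ((p'.1.1 : MulAut N) n))
    (hG : ∀ x, (p.1.2 : MulAut G) (X.q x) = (p'.1.2 : MulAut G) (X.q x)) : p = p' := by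
  refine Subtype.ext (Prod.ext (Subtype.ext (MulEquiv.ext fun n => X.ι_injective (hN n)))
    (Subtype.ext (MulEquiv.ext fun g => ?_)))
  obtain ⟨x, rfl⟩ := X.q_surjective g
  exact hG x

/-- Multiplicativity is automatic, because injectivity of `ι` and surjectivity of `q` determine the
induced pair uniquely. -/
theorem exists_compHom (hX : X.HasKernel S) :
    ∃ Φ : X.Aut →* S.Comp,
      (∀ (ν : X.Aut) (n : N), X.ι (((Φ ν).1.1 : MulAut N) n) = (ν : MulAut H) (X.ι n)) ∧
      ∀ (ν : X.Aut) (x : H), ((Φ ν).1.2 : MulAut G) (X.q x) = X.q ((ν : MulAut H) x) := by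
  choose Φ hN hG using X.exists_comp hX
  refine ⟨MonoidHom.mk' Φ fun ν ν' => X.comp_ext (fun n => ?_) fun x => ?_, hN, hG⟩
  · rw [hN]
    simp [hN]
  · rw [hG]
    simp [hG]

/-- If `X` and `p.X` are equivalent, then `p` is induced by an automorphism. -/
theorem exists_aut_of_hasFactorSystem {p : LieAut K EN N × LieAut K EG G} {T : G → MulAut N}
    {ω : G × G → N} (hX : X.HasFactorSystem T ω) (hX' : (X.twist p).HasFactorSystem T ω) :
    ∃ ν : X.Aut, (∀ n, X.ι ((p.1 : MulAut N) n) = (ν : MulAut H) (X.ι n)) ∧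
      ∀ x, (p.2 : MulAut G) (X.q x) = X.q ((ν : MulAut H) x) := by
  obtain ⟨σ, hσ⟩ := hX.exists_section
  obtain ⟨σ', hσ'⟩ := hX'.exists_section
  -- The equivalence is taken from the twist to `X`: it then satisfies `f ∘ ι ∘ φ⁻¹ = ι` and `q ∘ f
  -- = ψ ∘ q`, so `f` itself induces `(φ, ψ)`.
  obtain ⟨f, hf, hf', hι, hq⟩ := hσ'.exists_equiv hσ
  have hι' : ∀ n, f (X.ι n) = X.ι ((p.1 : MulAut N) n) := fun n => by
    rw [← hι ((p.1 : MulAut N) n)]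
    simp [LieGroupExtension.twist]
  refine ⟨⟨f, ⟨hf, hf'⟩, ?_⟩, fun n => (hι' n).symm, fun x => (hq x).symm⟩
  rw [← range_comp, show f ∘ X.ι = X.ι ∘ (p.1 : MulAut N) from funext hι',
    (MulEquiv.surjective (p.1 : MulAut N)).range_comp]

end Induced

end LieGroupExtension

/-! ### The obstruction class `I` and the exact sequence -/

namespace LieGroupExtension

variable {K EN EH EG N H G : Type*} [RCLike K]
  [AddCommGroup EN] [Module K EN] [TopologicalSpace EN] [LocallyConvexTVS K EN]
  [AddCommGroup EH] [Module K EH] [TopologicalSpace EH] [LocallyConvexTVS K EH]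
  [AddCommGroup EG] [Module K EG] [TopologicalSpace EG] [LocallyConvexTVS K EG]
  [Group N] [TopologicalSpace N] [ChartedSpace EN N] [LCLieGroup K EN N]
  [Group H] [TopologicalSpace H] [ChartedSpace EH H] [LCLieGroup K EH H]
  [Group G] [TopologicalSpace G] [ChartedSpace EG G] [LCLieGroup K EG G]
  {S : SmoothOuterAction K EG EN G N} {X : LieGroupExtension K EN EH EG N H G}

/-- Let `X` have cocycle `ω` and `p'.X` have `β' ω`. Twisting by `p` and correcting by a fixed
cochain `f` turns `ω` into some `β ω`, a cocycle of `p.X`. It turns `β' ω` into `(p.β') β ω`, a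
cocycle of `p.(p'.X)`, which has the same inclusion and projection as `(p p').X`. -/
theorem IsClassShift.twist_mul {p p' : S.Comp} {c c' : S.H₂ss}
    (h : IsClassShift S c X (X.twist p)) (h' : IsClassShift S c' X (X.twist p')) :
    IsClassShift S (p • c' * c) X (X.twist (p * p' : S.Comp)) := by
  obtain ⟨β', ω, rfl, hX, hX'⟩ := h'
  obtain ⟨f, hf, e⟩ := p.2
  have hp := hX.shift_twist hf e
  obtain ⟨β, hβ⟩ := hX.exists_cocycle hp
  -- The data in `h` may involve another `ω`; uniqueness allows `c` to be computed from the `ω` used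
  -- for `p'`.
  rw [h.unique ⟨β, ω, rfl, hX, hβ ▸ hp⟩]
  refine ⟨⟨centralPull₂ p.1 β', S.pull_mem_Z₂ss p.2 β'.2⟩ * β, ω, rfl, hX, ?_⟩
  have h2 := (hX'.shift_twist hf e).twist_mul
  have h3 := shiftCocycle_mul_central (pairAct p.1 S.toFun) f (centralPull₂ p.1 β')
    (fun x => (p.1.1 : MulAut N) (ω ((p.1.2 : MulAut G)⁻¹ x.1, (p.1.2 : MulAut G)⁻¹ x.2)))
  rw [hβ] at h3
  refine Eq.subst (motive := (X.twist (p * p' : S.Comp)).HasFactorSystem S.toFun)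
    (Eq.trans (b := fun x => (centralPull₂ p.1 β' x : N) * ((β.1 x : N) * ω x)) ?_ ?_) h2
  · exact (congrArg (shiftCocycle _ f)
      (funext fun x => map_mul (p.1.1 : MulAut N) _ _)).trans h3
  · ext x
    simp [mul_assoc]

theorem exists_classShift (hX : X.HasKernel S) (p : S.Comp) :
    ∃ c : S.H₂ss, IsClassShift S c X (X.twist p) := by
  obtain ⟨ω, hω⟩ := hX.exists_hasFactorSystem
  obtain ⟨f, hf, e⟩ := p.2
  have hp := hω.shift_twist hf e
  obtain ⟨β, hβ⟩ := hω.exists_cocycle hp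
  exact ⟨β, β, ω, rfl, hω, hβ ▸ hp⟩

end LieGroupExtension

theorem theoremA9 {K EN EH EG N H G : Type*} [RCLike K]
    [AddCommGroup EN] [Module K EN] [TopologicalSpace EN] [LocallyConvexTVS K EN]
    [AddCommGroup EH] [Module K EH] [TopologicalSpace EH] [LocallyConvexTVS K EH]
    [AddCommGroup EG] [Module K EG] [TopologicalSpace EG] [LocallyConvexTVS K EG]
    [Group N] [TopologicalSpace N] [ChartedSpace EN N] [LCLieGroup K EN N]
    [Group H] [TopologicalSpace H] [ChartedSpace EH H] [LCLieGroup K EH H]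
    [Group G] [TopologicalSpace G] [ChartedSpace EG G] [LCLieGroup K EG G]
    (S : SmoothOuterAction K EG EN G N) (X : LieGroupExtension K EN EH EG N H G)
    (hX : X.HasKernel S) :
    ∃ (Ψ : S.Z₁ →* X.Aut) (Φ : X.Aut →* S.Comp) (I : S.Comp → S.H₂ss),
      (∀ (f : S.Z₁) (x : H), (Ψ f : MulAut H) x = X.ι (f.1 (X.q x)) * x) ∧
      (∀ (ν : X.Aut) (n : N), X.ι (((Φ ν).1.1 : MulAut N) n) = (ν : MulAut H) (X.ι n)) ∧
      (∀ (ν : X.Aut) (x : H), ((Φ ν).1.2 : MulAut G) (X.q x) = X.q ((ν : MulAut H) x)) ∧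
      (∀ (p : S.Comp) (c : S.H₂ss),
        LieGroupExtension.IsClassShift S c X (X.twist p) ↔ c = I p) ∧
      (∀ p p' : S.Comp, I (p * p') = p • I p' * I p) ∧
      Function.Injective Ψ ∧ Ψ.range = Φ.ker ∧ (∀ p : S.Comp, p ∈ Φ.range ↔ I p = 1) := by
  choose I hI using X.exists_classShift hX
  obtain ⟨Φ, hN, hG⟩ := X.exists_compHom hX
  refine ⟨X.ofCocycle hX, Φ, I, X.ofCocycle_apply hX, hN, hG,
    fun p c => ⟨fun h => h.unique (hI p), fun h => h ▸ hI p⟩,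
    fun p p' => (hI (p * p')).unique ((hI p).twist_mul (hI p')),
    X.ofCocycle_injective hX, ?_, fun p => ?_⟩
  · ext ν
    rw [MonoidHom.mem_range, MonoidHom.mem_ker]
    constructor
    · rintro ⟨f, rfl⟩
      refine X.comp_ext (fun n => ?_) fun x => ?_
      · rw [hN]
        exact X.cocycleEquiv_ι hX f n
      · rw [hG, X.ofCocycle_apply]
        simp
    · intro h
      exact X.exists_ofCocycle_eq hX ν (fun n => by simp [← hN, h]) fun x => by simp [← hG, h]
  · rw [MonoidHom.mem_range]
    constructor
    · rintro ⟨ν, rfl⟩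
      obtain ⟨ω, hω⟩ := hX.exists_hasFactorSystem
      exact (hI _).unique (LieGroupExtension.isClassShift_one_iff.2
        ⟨ω, hω, hω.twist_of_aut ν (hN ν) (hG ν)⟩)
    -- Trivial `I(p)` means that `X` and `p.X` share a factor system; the resulting equivalence is
    -- an automorphism of `H` lifting `p`.
    · intro h
      obtain ⟨ω, hω, hω'⟩ := LieGroupExtension.isClassShift_one_iff.1 (h ▸ hI p)
      obtain ⟨ν, hν, hν'⟩ := LieGroupExtension.exists_aut_of_hasFactorSystem hω hω'
      exact ⟨ν, X.comp_ext (fun n => by rw [hN, hν]) fun x => by rw [hG, hν']⟩
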